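/- Let $K$ be a field of characteristic $0$ (for instance $\mathbb{R}$ or $\mathbb{C}$) and let $N \ge 1$. Let $u$ be a scalar unknown and $U = (U_1,\dots,U_N)$ a vector unknown, write subscripts $x$ for $x$-derivatives and $\langle \partial_x^m U, \partial_x^n U\rangle = \sum_{j=1}^N (\partial_x^m U_j)(\partial_x^n U_j)$. Assign weight $1$ to $\partial_x$, $\lambda_1 = \frac13$ to $u$ and $\lambda_2=\frac23$ to $U$. Consider the second-order system $$u_{t} = a_1 u_{xx} + a_2 u^3 u_x + a_3 u^7 + a_4 \langle U,U_x\rangle + a_5 u^3\langle U,U\rangle,$$ $$U_{t} = a_6 U_{xx} + a_7 u^2 u_x U + a_8 u^3 U_x + a_9 u^6 U + a_{10} u^2 \langle U,U\rangle U$$ with $a_1,\dots,a_{10} \in K$ such that $(a_1,a_6)\ne(0,0)$, $(a_4,a_5)\neq(0,0)$ and $(a_7,a_8,a_9,a_{10})\neq(0,0,0,0)$. An evolutionary system in a time $\tau$ is called a symmetry of it if $\partial_\tau\partial_t u = \partial_t\partial_\tau u$ and $\partial_\tau\partial_t U = \partial_t\partial_\tau U$ hold identically as differential polynomials in $u, U_1,\dots,U_N$.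 Then: 1. The system has no symmetry of the form $$\begin{aligned} u_\tau ={}& b_1 u_{xxx} + b_2 u^3 u_{xx} + b_3 u^2 u_x^2 + b_4 u^6 u_x + b_5 u^{10} + b_6 \langle U,U_{xx}\rangle + b_7 \langle U_x,U_x\rangle \\ &+ b_8 u^2 u_x\langle U,U\rangle + b_9 u^3\langle U,U_x\rangle + b_{10} u^6 \langle U,U\rangle + b_{11} u^2 \langle U,U\rangle^2,\\ U_\tau ={}& b_{12} U_{xxx} + b_{13} u^2u_{xx} U + b_{14} u u_x^2 U + b_{15} u^2 u_x U_x + b_{16} u^3 U_{xx} + b_{17} u^5 u_x U + b_{18} u^6 U_x + b_{19} u^9 U \\ &+ b_{20} u u_x \langle U,U\rangle U + b_{21} u^2 \langle U,U\rangle U_x + b_{22} u^2 \langle U,U_x\rangle U + b_{23} u^5 \langle U,U\rangle U + b_{24} u \langle U,U\rangle^2 U \end{aligned}$$ with $b_1,\dots,b_{24}\in K$, $(b_1,b_{12})\ne(0,0)$, at least one of $b_1,\dots,b_{11}$ nonzero and at least one of $b_{12},\dots,b_{24}$ nonzero. 2. The system has no fourth-order symmetry, that is, no symmetry $u_\tau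 = F$, $U_\tau = G$ such that $F$ is a $K$-linear combination of products of the $\partial_x^i u$ and the $\langle \partial_x^m U,\partial_x^n U\rangle$, $G$ is a $K$-linear combination of such products times vectors $\partial_x^k U$, $F$ is homogeneous of weight $4+\frac13$ and $G$ is homogeneous of weight $4+\frac23$, both $F$ and $G$ are nonzero, and at least one of $F$, $G$ contains a fourth-order $x$-derivative of $u$ or of $U$. -/

import Mathlib

namespace MixedEvolution

open MvPolynomial

noncomputable section

/-- The jet variables: `u i` stands for `∂ₓⁱ u` and `U j i` stands for `∂ₓⁱ U_j`,
where `u` is the scalar unknown and `U = (U_1, …, U_N)` is the vector unknown. -/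
inductive JetVar (N : ℕ) : Type
  | u (i : ℕ) : JetVar N
  | U (j : Fin N) (i : ℕ) : JetVar N

/-- The order in `∂ₓ` of a jet variable. -/
def JetVar.order {N : ℕ} : JetVar N → ℕ
  | .u i => i
  | .U _ i => i

/-- The weight of a jet variable for `λ₁ = 1/3`, `λ₂ = 2/3`, where `∂ₓ` has weight `1`. -/
def JetVar.weight {N : ℕ} : JetVar N → ℚ
  | .u i => 1 / 3 + i
  | .U _ i => 2 / 3 + i

/-- Differential polynomials in `u` and `U_1, …, U_N` with constant coefficients in `K`. -/
abbrev DiffPoly (K : Type*) [Field K] (N : ℕ) := MvPolynomial (JetVar N) K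

variable (K : Type*) [Field K] (N : ℕ)

/-- The differential polynomial `∂ₓⁱ u`. -/
def du (i : ℕ) : DiffPoly K N := X (JetVar.u i)

/-- The vector of differential polynomials `∂ₓⁱ U`. -/
def dU (i : ℕ) : Fin N → DiffPoly K N := fun j => X (JetVar.U j i)

/-- The scalar product `⟨∂ₓᵐ U, ∂ₓⁿ U⟩`. -/
def sca (m n : ℕ) : DiffPoly K N := ∑ j : Fin N, dU K N m j * dU K N n j

/-- The total `x`-derivative. -/
def totalDeriv : Derivation K (DiffPoly K N) (DiffPoly K N) :=
  mkDerivation K fun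
    | .u i => X (.u (i + 1))
    | .U j i => X (.U j (i + 1))

/-- An evolutionary system `u_t = scalar`, `U_t = vector`. -/
structure EvolSystem where
  scalar : DiffPoly K N
  vector : Fin N → DiffPoly K N

variable {K N}

/-- The `t`-derivative of differential polynomials along the flow `u_t = scalar`, `U_t = vector`:
the derivation that commutes with `∂ₓ` and maps `u` to `scalar` and `U_j` to `vector j`. -/
def EvolSystem.flow (S : EvolSystem K N) : Derivation K (DiffPoly K N) (DiffPoly K N) :=
  mkDerivation K fun
    | .u i => (totalDeriv K N)^[i] S.scalar
    | .U j i => (totalDeriv K N)^[i] (S.vector j)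

/-- `T` (with time `τ`) is a symmetry of `S` (with time `t`): the two flows commute, i.e.
`u_{tτ} = u_{τt}` and `U_{tτ} = U_{τt}` identically as differential polynomials. -/
def EvolSystem.IsSymmetry (T S : EvolSystem K N) : Prop :=
  S.flow T.scalar = T.flow S.scalar ∧ ∀ j, S.flow (T.vector j) = T.flow (S.vector j)

/-- The system contains an `x`-derivative of order `n` of `u` or of some `U_j`. -/
def EvolSystem.InvolvesOrder (S : EvolSystem K N) (n : ℕ) : Prop :=
  (∃ v ∈ S.scalar.vars, v.order = n) ∨ ∃ j, ∃ v ∈ (S.vector j).vars, v.order = n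

variable (K N)

/-- The scalar differential polynomials: polynomials in the `∂ₓⁱ u` and the `⟨∂ₓᵐ U, ∂ₓⁿ U⟩`. -/
def scalarPolys : Subalgebra K (DiffPoly K N) :=
  Algebra.adjoin K
    ({p | ∃ i, p = du K N i} ∪ {p | ∃ m n, p = sca K N m n})

/-- The vector differential polynomials: linear combinations of the `∂ₓᵏ U` whose coefficients
are scalar differential polynomials. -/
def vectorPolys : Submodule K (Fin N → DiffPoly K N) :=
  Submodule.span K {G | ∃ p ∈ scalarPolys K N, ∃ k, G = p • dU K N k}

variable {K N}

/-- The general `(1/3, 2/3)`-homogeneous mixed scalar-vector system of weight `μ`: the right-hand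
side of the scalar equation is a scalar differential polynomial of weight `μ + 1/3`, and that of
the vector equation is a vector differential polynomial of weight `μ + 2/3`. -/
def EvolSystem.IsHomogeneous (S : EvolSystem K N) (μ : ℕ) : Prop :=
  S.scalar ∈ scalarPolys K N ∧
  S.vector ∈ vectorPolys K N ∧
  IsWeightedHomogeneous JetVar.weight S.scalar ((μ : ℚ) + 1 / 3) ∧
  ∀ j, IsWeightedHomogeneous JetVar.weight (S.vector j) ((μ : ℚ) + 2 / 3)

variable (N)

/-- The general `(1/3, 2/3)`-homogeneous system of second order
(coefficients numbered from `0`). -/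
def secondOrder (a : Fin 10 → K) : EvolSystem K N :=
  let u := du K N
  let U := dU K N
  let s := sca K N
  { scalar :=
      a 0 • u 2 + a 1 • (u 0 ^ 3 * u 1) + a 2 • u 0 ^ 7
        + a 3 • s 0 1 + a 4 • (u 0 ^ 3 * s 0 0)
    vector :=
      a 5 • U 2 + a 6 • (u 0 ^ 2 * u 1) • U 0 + a 7 • (u 0 ^ 3) • U 1 + a 8 • (u 0 ^ 6) • U 0
        + a 9 • (u 0 ^ 2 * s 0 0) • U 0 }

/-- The general `(1/3, 2/3)`-homogeneous system of third order
(coefficients numbered from `0`). -/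
def thirdOrder (b : Fin 24 → K) : EvolSystem K N :=
  let u := du K N
  let U := dU K N
  let s := sca K N
  { scalar :=
      b 0 • u 3 + b 1 • (u 0 ^ 3 * u 2) + b 2 • (u 0 ^ 2 * u 1 ^ 2) + b 3 • (u 0 ^ 6 * u 1)
        + b 4 • u 0 ^ 10 + b 5 • s 0 2
        + b 6 • s 1 1 + b 7 • (u 0 ^ 2 * u 1 * s 0 0) + b 8 • (u 0 ^ 3 * s 0 1)
        + b 9 • (u 0 ^ 6 * s 0 0)
        + b 10 • (u 0 ^ 2 * s 0 0 ^ 2)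
    vector :=
      b 11 • U 3 + b 12 • (u 0 ^ 2 * u 2) • U 0 + b 13 • (u 0 * u 1 ^ 2) • U 0
        + b 14 • (u 0 ^ 2 * u 1) • U 1 + b 15 • (u 0 ^ 3) • U 2
        + b 16 • (u 0 ^ 5 * u 1) • U 0 + b 17 • (u 0 ^ 6) • U 1 + b 18 • (u 0 ^ 9) • U 0
        + b 19 • (u 0 * u 1 * s 0 0) • U 0
        + b 20 • (u 0 ^ 2 * s 0 0) • U 1
        + b 21 • (u 0 ^ 2 * s 0 1) • U 0 + b 22 • (u 0 ^ 5 * s 0 0) • U 0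
        + b 23 • (u 0 * s 0 0 ^ 2) • U 0 }

variable {N}

/-- The constraints on a second-order system: it has order `2`, `U` occurs in the scalar equation,
and `u` occurs in the vector equation. -/
def IsCoupledSecondOrder (a : Fin 10 → K) : Prop :=
  (a 0 ≠ 0 ∨ a 5 ≠ 0) ∧ (a 3 ≠ 0 ∨ a 4 ≠ 0) ∧ (a 6 ≠ 0 ∨ a 7 ≠ 0 ∨ a 8 ≠ 0 ∨ a 9 ≠ 0)

/-- The constraints on a third-order symmetry: it has order `3`, and neither equation has only
zero coefficients. -/
def IsThirdOrderSymmetryAnsatz (b : Fin 24 → K) : Prop :=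
  (b 0 ≠ 0 ∨ b 11 ≠ 0) ∧ (∃ i : Fin 24, i.val ≤ 10 ∧ b i ≠ 0) ∧
    (∃ i : Fin 24, 11 ≤ i.val ∧ b i ≠ 0)

/-- The constraints on a fourth-order symmetry: it is homogeneous of weight `4`, it has order `4`,
and both right-hand sides are nonzero. -/
def EvolSystem.IsFourthOrderSymmetryAnsatz (T : EvolSystem K N) : Prop :=
  T.IsHomogeneous 4 ∧ T.InvolvesOrder 4 ∧ T.scalar ≠ 0 ∧ T.vector ≠ 0

end

end MixedEvolution

/-! Grade differential polynomials by the pair (degree in `u`, degree in `U`). The second-order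
system splits into a linear part and parts that shift this bidegree by (3,0), (6,0), (-1,2) and
(2,2). A symmetry `T` splits likewise, and its part of shift 0 is the linear system `u_τ = α ∂ₓⁿ u`,
`U_τ = β ∂ₓⁿ U` with `(α, β) ≠ 0` and `n = 3` or `4`. This is all that is needed of `T`, so both
orders are treated at once (`not_isSymmetry_of_linear_part`).

Each bihomogeneous component of the commutator vanishes separately. If the lower parts contribute
nothing, the component of shift `e` reads [linear part of S, `T_e`] = [linear part of T, `S_e`].
Substituting superpositions of exponentials makes this scalar: Q · (symbol of `T_e`) = C · (symbol
of `S_e`), where Q and C depend only on the exponents. Hence the symbol of `S_e` vanishes wherever Q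
= 0 and C ≠ 0 (`symb_map_eq_zero`), and suitable points over the algebraic closure kill the
coefficients of `S_e`.

If `a 0` or `α` is nonzero, the vector equation is treated in the shifts (3,0), (6,0), (2,2), and `a
6`, …, `a 9` all vanish (`vector_coeffs_eq_zero`). To pass beyond (3,0), the vector part of `T` of
that shift must vanish, which is `eq_zero_of_linFlow_eq`. If `a 0 = α = 0`, the scalar equation in
the shifts (-1,2), (2,2) gives `a 3 = a 4 = 0` (`scalar_coeffs_eq_zero`). Either outcome contradicts
the coupling. -/

namespace MixedEvolution

open MvPolynomial

noncomputable section

/-! ### The bigrading and its behaviour under flows -/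

section

variable {K : Type*} [Field K] {N : ℕ}

/-- The bidegree of a jet variable: its degree in `u` and its degree in `U`. -/
def bidegree : JetVar N → ℤ × ℤ
  | .u _ => (1, 0)
  | .U _ _ => (0, 1)

/-- The component of bidegree `e` of a differential polynomial. -/
abbrev bicomp (e : ℤ × ℤ) : DiffPoly K N →ₗ[K] DiffPoly K N :=
  weightedHomogeneousComponent bidegree e

/-- A differential polynomial all of whose monomials have bidegree `e`. -/
abbrev IsBihom (p : DiffPoly K N) (e : ℤ × ℤ) : Prop := IsWeightedHomogeneous bidegree p e

theorem bicomp_same {p : DiffPoly K N} {e : ℤ × ℤ} (h : IsBihom p e) : bicomp e p = p :=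
  h.weightedHomogeneousComponent_same

theorem bicomp_ne {p : DiffPoly K N} {e m : ℤ × ℤ} (h : IsBihom p e) (hm : m ≠ e) :
    bicomp m p = 0 :=
  h.weightedHomogeneousComponent_ne m hm

theorem isBihom_bicomp (e : ℤ × ℤ) (p : DiffPoly K N) : IsBihom (bicomp e p) e :=
  weightedHomogeneousComponent_isWeightedHomogeneous e p

theorem IsBihom.smul {p : DiffPoly K N} {e : ℤ × ℤ} (h : IsBihom p e) (c : K) :
    IsBihom (c • p) e :=
  (weightedHomogeneousSubmodule K bidegree e).smul_mem c h

theorem bicomp_mul {h : DiffPoly K N} {c : ℤ × ℤ} (hh : IsBihom h c) (m : ℤ × ℤ)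
    (p : DiffPoly K N) : bicomp m (h * p) = h * bicomp (m - c) p := by
  induction p using MvPolynomial.induction_on' with
  | monomial d a =>
    have hd : IsBihom (monomial d a : DiffPoly K N) (Finsupp.weight bidegree d) :=
      isWeightedHomogeneous_monomial _ _ _ rfl
    by_cases hm : m = c + Finsupp.weight bidegree d
    · rw [hm, bicomp_same (hh.mul hd), add_sub_cancel_left, bicomp_same hd]
    · rw [bicomp_ne (hh.mul hd) hm, bicomp_ne hd, mul_zero]
      exact fun h' => hm (by rw [← h']; abel)
  | add p q hp hq => rw [mul_add, map_add, hp, hq, map_add, mul_add]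

theorem bicomp_derivation (d : Derivation K (DiffPoly K N) (DiffPoly K N)) {c : ℤ × ℤ}
    (hd : ∀ v, IsBihom (d (X v)) (bidegree v + c)) (m : ℤ × ℤ) (p : DiffPoly K N) :
    bicomp m (d p) = d (bicomp (m - c) p) := by
  induction p using MvPolynomial.induction_on generalizing m with
  | C a =>
    have h : IsBihom (C a : DiffPoly K N) 0 := isWeightedHomogeneous_C _ a
    by_cases hm : m - c = 0
    · rw [hm, bicomp_same h, derivation_C, map_zero]
    · rw [bicomp_ne h hm, derivation_C, map_zero, map_zero]
  | add p q hp hq => simp only [map_add, hp, hq]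
  | mul_X p v hp =>
    have hX : IsBihom (X v : DiffPoly K N) (bidegree v) := isWeightedHomogeneous_X _ _ v
    have e1 : m - (bidegree v + c) = m - c - bidegree v := by abel
    have e2 : m - bidegree v - c = m - c - bidegree v := by abel
    rw [mul_comm p, Derivation.leibniz, smul_eq_mul, smul_eq_mul, map_add, bicomp_mul hX, hp,
      mul_comm p, bicomp_mul (hd v), bicomp_mul hX, Derivation.leibniz, smul_eq_mul, smul_eq_mul,
      e1, e2, mul_comm (d (X v))]

theorem bicomp_eq_zero_of_neg {e : ℤ × ℤ} (he : e.1 < 0 ∨ e.2 < 0) (p : DiffPoly K N) :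
    bicomp e p = 0 := by
  refine (isBihom_bicomp e p).eq_zero_of_no_monomials fun d hd => ?_
  have h0 : (0 : ℤ × ℤ) ≤ Finsupp.weight bidegree d := by
    rw [Finsupp.weight_apply]
    refine Finset.sum_nonneg fun v _ => nsmul_nonneg ?_ _
    cases v <;> simp [bidegree, Prod.le_def]
  rw [hd] at h0
  have := h0.1
  have := h0.2
  simp only [Prod.fst_zero, Prod.snd_zero] at *
  omega

/-- The flow of the linear system `u_t = α ∂ₓⁿ u`, `U_t = β ∂ₓⁿ U`. -/
def linFlow (n : ℕ) (α β : K) : Derivation K (DiffPoly K N) (DiffPoly K N) :=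
  mkDerivation K fun
    | .u i => α • X (.u (i + n))
    | .U j i => β • X (.U j (i + n))

@[simp]
theorem linFlow_u (n : ℕ) (α β : K) (i : ℕ) :
    linFlow n α β (X (.u i) : DiffPoly K N) = α • X (.u (i + n)) :=
  mkDerivation_X _ _ _

@[simp]
theorem linFlow_U (n : ℕ) (α β : K) (j : Fin N) (i : ℕ) :
    linFlow n α β (X (.U j i) : DiffPoly K N) = β • X (.U j (i + n)) :=
  mkDerivation_X _ _ _

theorem totalDeriv_eq_linFlow : totalDeriv K N = linFlow 1 1 1 := by
  refine derivation_ext fun v => ?_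
  cases v <;> simp [totalDeriv, mkDerivation_X]

@[simp]
theorem totalDeriv_u (i : ℕ) : totalDeriv K N (X (.u i)) = X (.u (i + 1)) :=
  mkDerivation_X _ _ _

@[simp]
theorem totalDeriv_U (j : Fin N) (i : ℕ) : totalDeriv K N (X (.U j i)) = X (.U j (i + 1)) :=
  mkDerivation_X _ _ _

@[simp]
theorem iterate_totalDeriv_u (n i : ℕ) :
    (totalDeriv K N)^[n] (X (.u i)) = X (.u (i + n)) := by
  induction n generalizing i with
  | zero => rfl
  | succ n ih => rw [Function.iterate_succ_apply, totalDeriv_u, ih, add_right_comm, add_assoc]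

@[simp]
theorem iterate_totalDeriv_U (n : ℕ) (j : Fin N) (i : ℕ) :
    (totalDeriv K N)^[n] (X (.U j i)) = X (.U j (i + n)) := by
  induction n generalizing i with
  | zero => rfl
  | succ n ih => rw [Function.iterate_succ_apply, totalDeriv_U, ih, add_right_comm, add_assoc]

theorem iterate_totalDeriv_eq_pow (n : ℕ) (p : DiffPoly K N) :
    (totalDeriv K N)^[n] p = ((totalDeriv K N : DiffPoly K N →ₗ[K] DiffPoly K N) ^ n) p := by
  rw [Module.End.pow_apply]; rfl

theorem bicomp_totalDeriv (m : ℤ × ℤ) (p : DiffPoly K N) :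
    bicomp m (totalDeriv K N p) = totalDeriv K N (bicomp m p) := by
  have h := bicomp_derivation (totalDeriv K N) (c := 0) (fun v => ?_) m p
  · rwa [sub_zero] at h
  · cases v
    · rw [totalDeriv_u, add_zero]; exact isWeightedHomogeneous_X _ _ _
    · rw [totalDeriv_U, add_zero]; exact isWeightedHomogeneous_X _ _ _

theorem bicomp_iterate_totalDeriv (m : ℤ × ℤ) (n : ℕ) (p : DiffPoly K N) :
    bicomp m ((totalDeriv K N)^[n] p) = (totalDeriv K N)^[n] (bicomp m p) := by
  induction n generalizing p with
  | zero => rfl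
  | succ n ih => rw [Function.iterate_succ_apply, ih, bicomp_totalDeriv, Function.iterate_succ_apply]

theorem IsBihom.iterate_totalDeriv {p : DiffPoly K N} {e : ℤ × ℤ} (h : IsBihom p e) (n : ℕ) :
    IsBihom ((totalDeriv K N)^[n] p) e := by
  rw [← bicomp_same h, ← bicomp_iterate_totalDeriv]
  exact isBihom_bicomp _ _

namespace EvolSystem

@[simp]
theorem flow_u (S : EvolSystem K N) (i : ℕ) :
    S.flow (X (.u i)) = (totalDeriv K N)^[i] S.scalar :=
  mkDerivation_X _ _ _

@[simp]
theorem flow_U (S : EvolSystem K N) (j : Fin N) (i : ℕ) :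
    S.flow (X (.U j i)) = (totalDeriv K N)^[i] (S.vector j) :=
  mkDerivation_X _ _ _

/-- The part of a system that raises the bidegree by `e`. -/
def part (T : EvolSystem K N) (e : ℤ × ℤ) : EvolSystem K N where
  scalar := bicomp (e + (1, 0)) T.scalar
  vector := fun j => bicomp (e + (0, 1)) (T.vector j)

/-- A system that raises the bidegree by `c`. -/
structure IsShift (S : EvolSystem K N) (c : ℤ × ℤ) : Prop where
  scalar : IsBihom S.scalar ((1, 0) + c)
  vector : ∀ j, IsBihom (S.vector j) ((0, 1) + c)

theorem IsShift.bicomp_flow {S : EvolSystem K N} {c : ℤ × ℤ} (hS : S.IsShift c) (m : ℤ × ℤ)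
    (p : DiffPoly K N) : bicomp m (S.flow p) = S.flow (bicomp (m - c) p) := by
  refine bicomp_derivation _ (fun v => ?_) m p
  cases v
  · rw [flow_u]; exact hS.scalar.iterate_totalDeriv _
  · rw [flow_U]; exact (hS.vector _).iterate_totalDeriv _

/-- The system `T` need not be a shift. On a monomial of known bidegree, however, only one part of
`T` can land in bidegree `m`. The Leibniz rule reduces this to a single variable. -/
theorem bicomp_flow_monomial (T : EvolSystem K N) (d : JetVar N →₀ ℕ) (a : K) (m : ℤ × ℤ) :
    bicomp m (T.flow (monomial d a)) =
      (T.part (m - Finsupp.weight bidegree d)).flow (monomial d a) := by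
  induction d using Finsupp.induction_linear generalizing a m with
  | zero => rw [show monomial 0 a = (C a : DiffPoly K N) from rfl]; simp
  | add d e hd he =>
    have h1 : IsBihom (monomial d a : DiffPoly K N) (Finsupp.weight bidegree d) :=
      isWeightedHomogeneous_monomial _ _ _ rfl
    have h2 : IsBihom (monomial e 1 : DiffPoly K N) (Finsupp.weight bidegree e) :=
      isWeightedHomogeneous_monomial _ _ _ rfl
    have h : (monomial (d + e) a : DiffPoly K N) = monomial d a * monomial e 1 := by
      rw [monomial_mul, mul_one]
    rw [h, Derivation.leibniz, Derivation.leibniz, map_add, smul_eq_mul, smul_eq_mul,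
      bicomp_mul h1, bicomp_mul h2, hd, he, map_add, sub_sub, sub_sub,
      add_comm (Finsupp.weight bidegree e), smul_eq_mul, smul_eq_mul]
  | single v k =>
    rw [Finsupp.weight_single]
    induction k generalizing a m with
    | zero => rw [Finsupp.single_zero, show monomial 0 a = (C a : DiffPoly K N) from rfl]; simp
    | succ k ih =>
      have h1 : IsBihom (monomial (Finsupp.single v k) a : DiffPoly K N) (k • bidegree v) :=
        isWeightedHomogeneous_monomial _ _ _ (Finsupp.weight_single _ _ _)
      have h2 : IsBihom (X v : DiffPoly K N) (bidegree v) := isWeightedHomogeneous_X _ _ v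
      have hX : ∀ m, bicomp m (T.flow (X v)) = (T.part (m - bidegree v)).flow (X v) := fun m => by
        cases v
        · simp [bicomp_iterate_totalDeriv, part, bidegree]
        · simp [bicomp_iterate_totalDeriv, part, bidegree]
      have h : (monomial (Finsupp.single v (k + 1)) a : DiffPoly K N) =
          monomial (Finsupp.single v k) a * X v := by
        rw [X, monomial_mul, mul_one, Finsupp.single_add]
      rw [h, Derivation.leibniz, Derivation.leibniz, map_add, smul_eq_mul, smul_eq_mul,
        bicomp_mul h1, bicomp_mul h2, hX, ih, succ_nsmul, sub_sub, sub_sub,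
        add_comm (bidegree v), smul_eq_mul, smul_eq_mul]

theorem bicomp_flow_of_isBihom (T : EvolSystem K N) {f : DiffPoly K N} {c : ℤ × ℤ}
    (hf : IsBihom f c) (m : ℤ × ℤ) : bicomp m (T.flow f) = (T.part (m - c)).flow f := by
  rw [f.as_sum, map_sum, map_sum, map_sum]
  refine Finset.sum_congr rfl fun d hd => ?_
  rw [bicomp_flow_monomial, hf (mem_support_iff.1 hd)]

end EvolSystem

end

/-! ### Splitting the commutator into bihomogeneous components -/

section

variable {K : Type*} [Field K] {N : ℕ}

namespace EvolSystem

theorem flow_eq_sum {ι : Type*} [Fintype ι] {S : EvolSystem K N} {P : ι → EvolSystem K N}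
    (hs : S.scalar = ∑ i, (P i).scalar) (hv : ∀ j, S.vector j = ∑ i, (P i).vector j)
    (p : DiffPoly K N) : S.flow p = ∑ i, (P i).flow p := by
  have hsum : ∀ q, (∑ i, (P i).flow) q = ∑ i, (P i).flow q := fun q => by
    rw [← Finset.sum_apply]
    exact congrFun (map_sum Derivation.coeFnAddMonoidHom (fun i => (P i).flow) _) q
  have h : S.flow = ∑ i, (P i).flow := by
    refine derivation_ext fun v => ?_
    rw [hsum]
    cases v with
    | u i => simp only [flow_u, hs, iterate_totalDeriv_eq_pow, map_sum]
    | U j i => simp only [flow_U, hv, iterate_totalDeriv_eq_pow, map_sum]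
  rw [h, hsum]

/-- The components of the commutator of two flows. -/
theorem IsSymmetry.part_commute {ι : Type*} [Fintype ι] {S T : EvolSystem K N}
    (hT : T.IsSymmetry S) {P : ι → EvolSystem K N} {c : ι → ℤ × ℤ}
    (hP : ∀ i, (P i).IsShift (c i)) (hs : S.scalar = ∑ i, (P i).scalar)
    (hv : ∀ j, S.vector j = ∑ i, (P i).vector j) (e : ℤ × ℤ) :
    (∑ i, (P i).flow (T.part (e - c i)).scalar = ∑ i, (T.part (e - c i)).flow (P i).scalar) ∧
      ∀ j, ∑ i, (P i).flow ((T.part (e - c i)).vector j) =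
        ∑ i, (T.part (e - c i)).flow ((P i).vector j) := by
  constructor
  · have h := congrArg (bicomp (e + (1, 0))) hT.1
    rw [flow_eq_sum hs hv, hs, map_sum, map_sum, map_sum] at h
    have e1 : ∀ i, e + (1, 0) - c i = e - c i + (1, 0) := fun i => by abel
    have e2 : ∀ i, e + (1, 0) - ((1, 0) + c i) = e - c i := fun i => by abel
    simpa only [part, (hP _).bicomp_flow, bicomp_flow_of_isBihom T (hP _).scalar, e1, e2] using h
  · intro j
    have h := congrArg (bicomp (e + (0, 1))) (hT.2 j)
    rw [flow_eq_sum hs hv, hv, map_sum, map_sum, map_sum] at h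
    have e1 : ∀ i, e + (0, 1) - c i = e - c i + (0, 1) := fun i => by abel
    have e2 : ∀ i, e + (0, 1) - ((0, 1) + c i) = e - c i := fun i => by abel
    simpa only [part, (hP _).bicomp_flow, bicomp_flow_of_isBihom T ((hP _).vector j), e1, e2] using h

theorem flow_eq_linFlow {S : EvolSystem K N} {n : ℕ} {α β : K} (hs : S.scalar = α • du K N n)
    (hv : ∀ j, S.vector j = β • dU K N n j) : S.flow = linFlow n α β := by
  refine derivation_ext fun v => ?_
  cases v with
  | u i =>
    rw [flow_u, hs, linFlow_u, iterate_totalDeriv_eq_pow, map_smul, ← iterate_totalDeriv_eq_pow,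
      du, iterate_totalDeriv_u, add_comm]
  | U j i =>
    rw [flow_U, hv, linFlow_U, iterate_totalDeriv_eq_pow, map_smul, ← iterate_totalDeriv_eq_pow,
      dU, iterate_totalDeriv_U, add_comm]

theorem flow_eq_zero {S : EvolSystem K N} (hs : S.scalar = 0) (hv : ∀ j, S.vector j = 0) :
    S.flow = 0 := by
  refine derivation_ext fun v => ?_
  cases v with
  | u i => rw [flow_u, hs, iterate_totalDeriv_eq_pow, map_zero]; rfl
  | U j i => rw [flow_U, hv, iterate_totalDeriv_eq_pow, map_zero]; rfl

theorem part_flow_eq_zero (T : EvolSystem K N) {e : ℤ × ℤ} (he : e.1 < -1 ∨ e.2 < -1) :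
    (T.part e).flow = 0 := by
  refine flow_eq_zero (bicomp_eq_zero_of_neg ?_ _) fun j => bicomp_eq_zero_of_neg ?_ _ <;>
    simp only [Prod.fst_add, Prod.snd_add, add_zero] <;> omega

end EvolSystem

variable (N)

/-- The part of the second-order system that raises the bidegree by `(3, 0)`. -/
def cubicPart (a : Fin 10 → K) : EvolSystem K N where
  scalar := a 1 • (du K N 0 ^ 3 * du K N 1)
  vector j := a 6 • (du K N 0 ^ 2 * du K N 1 * dU K N 0 j) + a 7 • (du K N 0 ^ 3 * dU K N 1 j)

/-- The bihomogeneous parts of the second-order system. -/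
def secondOrderPart (a : Fin 10 → K) : Fin 5 → EvolSystem K N :=
  ![⟨a 0 • du K N 2, fun j => a 5 • dU K N 2 j⟩,
    cubicPart N a,
    ⟨a 2 • du K N 0 ^ 7, fun j => a 8 • (du K N 0 ^ 6 * dU K N 0 j)⟩,
    ⟨a 3 • sca K N 0 1, fun _ => 0⟩,
    ⟨a 4 • (du K N 0 ^ 3 * sca K N 0 0),
      fun j => a 9 • (du K N 0 ^ 2 * sca K N 0 0 * dU K N 0 j)⟩]

/-- The shifts of the bidegree by the parts of the second-order system. -/
def secondOrderShift : Fin 5 → ℤ × ℤ := ![0, (3, 0), (6, 0), (-1, 2), (2, 2)]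

variable {N}

theorem isBihom_du (i : ℕ) : IsBihom (du K N i) (1, 0) := isWeightedHomogeneous_X _ _ _

theorem isBihom_dU (i : ℕ) (j : Fin N) : IsBihom (dU K N i j) (0, 1) :=
  isWeightedHomogeneous_X _ _ _

theorem isBihom_sca (m n : ℕ) : IsBihom (sca K N m n) (0, 2) :=
  IsWeightedHomogeneous.sum _ _ _ fun j _ => (isBihom_dU m j).mul (isBihom_dU n j)

theorem secondOrderPart_isShift (a : Fin 10 → K) (i : Fin 5) :
    (secondOrderPart N a i).IsShift (secondOrderShift i) := by
  fin_cases i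
  · exact ⟨IsBihom.smul (isBihom_du 2) _, fun j => IsBihom.smul (isBihom_dU 2 j) _⟩
  · exact ⟨IsBihom.smul (((isBihom_du 0).pow 3).mul (isBihom_du 1)) _, fun j =>
      (IsBihom.smul ((((isBihom_du 0).pow 2).mul (isBihom_du 1)).mul (isBihom_dU 0 j)) _).add
        (IsBihom.smul (((isBihom_du 0).pow 3).mul (isBihom_dU 1 j)) _)⟩
  · exact ⟨IsBihom.smul ((isBihom_du 0).pow 7) _, fun j =>
      IsBihom.smul (((isBihom_du 0).pow 6).mul (isBihom_dU 0 j)) _⟩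
  · exact ⟨IsBihom.smul (isBihom_sca 0 1) _, fun j => isWeightedHomogeneous_zero _ _ _⟩
  · exact ⟨IsBihom.smul (((isBihom_du 0).pow 3).mul (isBihom_sca 0 0)) _, fun j =>
      IsBihom.smul ((((isBihom_du 0).pow 2).mul (isBihom_sca 0 0)).mul (isBihom_dU 0 j)) _⟩

theorem secondOrder_scalar (a : Fin 10 → K) :
    (secondOrder N a).scalar = ∑ i, (secondOrderPart N a i).scalar := by
  simp only [secondOrder, secondOrderPart, cubicPart, Fin.sum_univ_five, Matrix.cons_val]

theorem secondOrder_vector (a : Fin 10 → K) (j : Fin N) :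
    (secondOrder N a).vector j = ∑ i, (secondOrderPart N a i).vector j := by
  simp only [secondOrder, secondOrderPart, cubicPart, Fin.sum_univ_five, Matrix.cons_val,
    Pi.add_apply, Pi.smul_apply, smul_eq_mul]
  abel

end

/-! ### Injectivity of the linearised equations -/

section

variable {K : Type*} [Field K] {N : ℕ}

theorem pderiv_ne_zero_of_mem_vars {σ : Type*} [CharZero K] {p : MvPolynomial σ K} {v : σ}
    (hv : v ∈ p.vars) : pderiv v p ≠ 0 := by
  classical
  obtain ⟨d, hd, hvd⟩ := (mem_vars_iff_mem_support v).1 hv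
  have hle : Finsupp.single v 1 ≤ d := by
    rw [Finsupp.single_le_iff]
    exact Nat.one_le_iff_ne_zero.2 (Finsupp.mem_support_iff.1 hvd)
  intro h
  have h1 := coeff_pderiv (i := v) p (d - Finsupp.single v 1)
  rw [h, coeff_zero, tsub_add_cancel_of_le hle] at h1
  refine mul_ne_zero (mem_support_iff.1 hd) ?_ h1.symm
  exact Nat.cast_add_one_ne_zero _

/-- If `pderiv y` annihilates `p`, then on `p` the operator `pderiv y ∘ d` is the commutator. -/
theorem pderiv_derivation_eq {σ : Type*} (d e : Derivation K (MvPolynomial σ K) (MvPolynomial σ K))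
    {p : MvPolynomial σ K} {y : σ} (h : ∀ x ∈ p.vars, pderiv y (d (X x)) = e (X x)) :
    pderiv y (d p) = d (pderiv y p) + e p := by
  let c : Derivation K (MvPolynomial σ K) (MvPolynomial σ K) := ⁅(pderiv y : Derivation K _ _), d⁆
  have h1 : c p = e p := by
    refine derivation_eq_of_forall_mem_vars fun x hx => ?_
    classical
    rw [show c = ⁅(pderiv y : Derivation K _ _), d⁆ from rfl, Derivation.commutator_apply, h x hx,
      pderiv_X, sub_eq_self]
    by_cases hxy : x = y
    · subst hxy; simp
    · simp [hxy]
  rw [← h1, show c = ⁅(pderiv y : Derivation K _ _), d⁆ from rfl, Derivation.commutator_apply]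
  abel

theorem exists_mem_vars_maximal_order {s : Set (JetVar N)} {p : DiffPoly K N}
    (h : ∃ v ∈ p.vars, v ∈ s) :
    ∃ v ∈ p.vars, v ∈ s ∧ ∀ x ∈ p.vars, x ∈ s → x.order ≤ v.order := by
  classical
  obtain ⟨v, hv, hvs⟩ := h
  obtain ⟨w, hw, hmax⟩ := (p.vars.filter (· ∈ s)).exists_max_image JetVar.order
    ⟨v, Finset.mem_filter.2 ⟨hv, hvs⟩⟩
  rw [Finset.mem_filter] at hw
  exact ⟨w, hw.1, hw.2, fun x hx hxs => hmax x (Finset.mem_filter.2 ⟨hx, hxs⟩)⟩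

theorem exists_u_mem_vars {p : DiffPoly K N} {e : ℤ × ℤ} (hp : IsBihom p e) (h0 : p ≠ 0)
    (he : e.1 ≠ 0) : ∃ i, JetVar.u i ∈ p.vars := by
  classical
  obtain ⟨d, hd⟩ := exists_coeff_ne_zero h0
  by_contra! h
  refine he ?_
  rw [← hp hd, Finsupp.weight_apply, Finsupp.sum, Prod.fst_sum]
  refine Finset.sum_eq_zero fun v hv => ?_
  cases v with
  | u i => exact absurd ((mem_vars_iff_mem_support _).2 ⟨d, mem_support_iff.2 hd, hv⟩) (h i)
  | U j i => simp [bidegree]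

theorem exists_U_mem_vars {p : DiffPoly K N} {e : ℤ × ℤ} (hp : IsBihom p e) (h0 : p ≠ 0)
    (he : e.2 ≠ 0) : ∃ j i, JetVar.U j i ∈ p.vars := by
  classical
  obtain ⟨d, hd⟩ := exists_coeff_ne_zero h0
  by_contra! h
  refine he ?_
  rw [← hp hd, Finsupp.weight_apply, Finsupp.sum, Prod.snd_sum]
  refine Finset.sum_eq_zero fun v hv => ?_
  cases v with
  | u i => simp [bidegree]
  | U j i => exact absurd ((mem_vars_iff_mem_support _).2 ⟨d, mem_support_iff.2 hd, hv⟩) (h j i)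

variable [CharZero K]

/-- If `u_i` is the highest derivative of `u` in `p`, then `u_{i+n}` enters `linFlow n α β p` only
through `u_i`, with coefficient `α ∂p/∂u_i ≠ 0`. -/
theorem linFlow_ne_zero_of_u {p : DiffPoly K N} {n : ℕ} (hn : n ≠ 0) {α β : K} (hα : α ≠ 0)
    (hp : ∃ i, JetVar.u i ∈ p.vars) : linFlow n α β p ≠ 0 := by
  classical
  obtain ⟨i₀, hi₀⟩ := hp
  obtain ⟨v, hv, ⟨i, rfl⟩, hmax⟩ :=
    exists_mem_vars_maximal_order (s := Set.range JetVar.u) ⟨_, hi₀, i₀, rfl⟩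
  have hy : JetVar.u (i + n) ∉ p.vars := fun h => by
    have := hmax _ h ⟨_, rfl⟩
    simp only [JetVar.order] at this
    omega
  intro h0
  have h := pderiv_derivation_eq (linFlow n α β) (α • pderiv (JetVar.u i)) (p := p)
    (y := JetVar.u (i + n)) fun x _ => by
      cases x <;> simp [pderiv_X, Pi.single_apply]
  rw [h0, pderiv_eq_zero_of_notMem_vars hy, map_zero, map_zero, zero_add, Derivation.smul_apply,
    eq_comm, smul_eq_zero_iff_right hα] at h
  exact pderiv_ne_zero_of_mem_vars hv h

theorem linFlow_ne_zero_of_U {p : DiffPoly K N} {n : ℕ} (hn : n ≠ 0) {α β : K} (hβ : β ≠ 0)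
    (hp : ∃ j i, JetVar.U j i ∈ p.vars) : linFlow n α β p ≠ 0 := by
  classical
  obtain ⟨j₀, i₀, hi₀⟩ := hp
  obtain ⟨v, hv, ⟨⟨j, i⟩, rfl⟩, hmax⟩ :=
    exists_mem_vars_maximal_order (s := Set.range fun x : Fin N × ℕ => JetVar.U x.1 x.2)
      ⟨_, hi₀, (j₀, i₀), rfl⟩
  have hy : JetVar.U j (i + n) ∉ p.vars := fun h => by
    have := hmax _ h ⟨(_, _), rfl⟩
    simp only [JetVar.order] at this
    omega
  intro h0
  have h := pderiv_derivation_eq (linFlow n α β) (β • pderiv (JetVar.U j i)) (p := p)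
    (y := JetVar.U j (i + n)) fun x _ => by
      cases x <;> simp [pderiv_X, Pi.single_apply]
  rw [h0, pderiv_eq_zero_of_notMem_vars hy, map_zero, map_zero, zero_add, Derivation.smul_apply,
    eq_comm, smul_eq_zero_iff_right hβ] at h
  exact pderiv_ne_zero_of_mem_vars hv h

/-- The linearised vector equation has no nonzero solution of bidegree `(3, 1)`. -/
theorem eq_zero_of_linFlow_eq {p : DiffPoly K N} (hp : IsBihom p (3, 1)) {α β : K}
    (hαβ : α ≠ 0 ∨ β ≠ 0)
    (h : linFlow 2 α β p = β • totalDeriv K N (totalDeriv K N p)) : p = 0 := by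
  classical
  by_contra h0
  by_cases hβ : β = 0
  · rw [hβ, zero_smul] at h
    exact linFlow_ne_zero_of_u two_ne_zero (hαβ.resolve_right (not_not.2 hβ))
      (exists_u_mem_vars hp h0 (by norm_num)) h
  obtain ⟨j₀, i₀, hi₀⟩ := exists_U_mem_vars hp h0 (by norm_num)
  obtain ⟨v, hv, ⟨⟨j, i⟩, rfl⟩, hmax⟩ :=
    exists_mem_vars_maximal_order (s := Set.range fun x : Fin N × ℕ => JetVar.U x.1 x.2)
      ⟨_, hi₀, (j₀, i₀), rfl⟩
  have hy : ∀ n ≠ 0, pderiv (JetVar.U j (i + n)) p = 0 := fun n hn =>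
    pderiv_eq_zero_of_notMem_vars fun h => by
      have := hmax _ h ⟨(_, _), rfl⟩
      simp only [JetVar.order] at this
      omega
  have hD : ∀ (i : ℕ) (q : DiffPoly K N), pderiv (JetVar.U j (i + 1)) (totalDeriv K N q) =
      totalDeriv K N (pderiv (JetVar.U j (i + 1)) q) + pderiv (JetVar.U j i) q := fun i q =>
    pderiv_derivation_eq _ _ fun x _ => by cases x <;> simp [pderiv_X, Pi.single_apply]
  have hbi : IsBihom (pderiv (JetVar.U j i) p) (3, 0) := by
    have := isBihom_bicomp (K := K) (N := N) (3, 0) (pderiv (JetVar.U j i) p)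
    rwa [bicomp_derivation _ (c := -(0, 1)) (fun v => ?_), show ((3, 0) - -(0, 1) : ℤ × ℤ) = (3, 1)
      from rfl, bicomp_same hp] at this
    rw [pderiv_X]
    rcases eq_or_ne v (JetVar.U j i) with rfl | hne
    · rw [Pi.single_eq_same, show bidegree (JetVar.U j i) + -(0, 1) = 0 from rfl]
      exact isWeightedHomogeneous_one _ _
    · rw [Pi.single_eq_of_ne' hne.symm]
      exact isWeightedHomogeneous_zero _ _ _
  -- The coefficient of the highest derivative of `U` still has degree 3 in `u`, so it is not
  -- constant and `∂ₓ` does not kill it. Comparing next-to-leading terms in `h` will force twice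
  -- this derivative to be zero.
  have hne : totalDeriv K N (pderiv (JetVar.U j i) p) ≠ 0 := by
    rw [totalDeriv_eq_linFlow]
    exact linFlow_ne_zero_of_u one_ne_zero one_ne_zero
      (exists_u_mem_vars hbi (pderiv_ne_zero_of_mem_vars hv) (by norm_num))
  have hyi := hy 1 one_ne_zero
  cases i with
  | zero =>
    -- With top order 0 there is no lower `U` variable, so the left side contributes nothing.
    have h1 := congrArg (pderiv (JetVar.U j 1)) h
    have hL := pderiv_derivation_eq (linFlow 2 α β) 0 (p := p) (y := JetVar.U j 1) fun x _ => by
      cases x <;> simp [pderiv_X]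
    have hD0 : pderiv (JetVar.U j 0) (totalDeriv K N p) =
        totalDeriv K N (pderiv (JetVar.U j 0) p) + (0 : Derivation K _ _) p :=
      pderiv_derivation_eq _ _ fun x _ => by cases x <;> simp [pderiv_X]
    have hD1 := hD 0 p
    have hD2 := hD 0 (totalDeriv K N p)
    simp only [zero_add, Derivation.zero_apply, add_zero] at hyi hL hD0 hD1 hD2
    rw [hL, hyi, map_zero, Derivation.map_smul, hD2, hD1, hyi, map_zero, zero_add, hD0, ← two_smul K,
      smul_smul, eq_comm, smul_eq_zero_iff_right (mul_ne_zero hβ two_ne_zero)] at h1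
    exact hne h1
  | succ i =>
    -- The top order is `i + 1`. One order above it, both sides contain `β ∂p/∂U_{j,i}`, which
    -- cancels; what remains is the cross term of `∂ₓ²`.
    have h1 := congrArg (pderiv (JetVar.U j (i + 1 + 1))) h
    have hL := pderiv_derivation_eq (linFlow 2 α β) (β • pderiv (JetVar.U j i)) (p := p)
      (y := JetVar.U j (i + 1 + 1)) fun x _ => by
        cases x <;> simp [pderiv_X, Pi.single_apply]
    rw [hL, hyi, map_zero, Derivation.map_smul, hD, hD, hyi, hD, map_zero, zero_add, zero_add,
      Derivation.smul_apply, smul_right_inj hβ, ← add_assoc, ← two_smul K,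
      right_eq_add, smul_eq_zero_iff_right two_ne_zero] at h1
    exact hne h1

end

/-! ### Symbols: substituting exponentials for the unknowns -/

section

variable {K : Type*} [Field K] {N : ℕ}

/-- The derivative of a differential polynomial in the direction of the exponential `exp (x ·)`
placed in the unknown `u` (for `none`) or in the unknown `U_j` (for `some j`). -/
def expDeriv (a : Option (Fin N) × K) : Derivation K (DiffPoly K N) (DiffPoly K N) :=
  mkDerivation K fun
    | .u i => if a.1 = none then C (a.2 ^ i) else 0
    | .U j i => if a.1 = some j then C (a.2 ^ i) else 0

theorem expDeriv_u (a : Option (Fin N) × K) (i : ℕ) :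
    expDeriv a (X (.u i)) = if a.1 = none then C (a.2 ^ i) else 0 :=
  mkDerivation_X _ _ _

theorem expDeriv_U (a : Option (Fin N) × K) (j : Fin N) (i : ℕ) :
    expDeriv a (X (.U j i)) = if a.1 = some j then C (a.2 ^ i) else 0 :=
  mkDerivation_X _ _ _

/-- The eigenvalue of the linear flow of order `n` on an exponential. -/
def expRate (n : ℕ) (α β : K) (a : Option (Fin N) × K) : K :=
  (if a.1 = none then α else β) * a.2 ^ n

/-- Exponentials are eigenvectors of linear flows with constant coefficients, so the commutator of
the two derivations is a multiple of `expDeriv a`. -/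
theorem expDeriv_linFlow (a : Option (Fin N) × K) (n : ℕ) (α β : K) (p : DiffPoly K N) :
    expDeriv a (linFlow n α β p) =
      linFlow n α β (expDeriv a p) + expRate n α β a • expDeriv a p := by
  have h : (⁅expDeriv a, linFlow n α β⁆ : Derivation K (DiffPoly K N) (DiffPoly K N)) =
      expRate n α β a • expDeriv a := by
    refine derivation_ext fun v => ?_
    rw [Derivation.commutator_apply, Derivation.smul_apply]
    cases v with
    | u i =>
      by_cases ha : a.1 = none
      · simp [expDeriv_u, expRate, ha, smul_eq_C_mul, pow_add]; ring
      · simp [expDeriv_u, ha]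
    | U j i =>
      by_cases ha : a.1 = some j
      · simp [expDeriv_U, expRate, ha, smul_eq_C_mul, pow_add]; ring
      · simp [expDeriv_U, ha]
  have h' := Derivation.congr_fun h p
  rw [Derivation.commutator_apply, Derivation.smul_apply] at h'
  rw [← h']
  abel

/-- The symbol of a differential polynomial: the coefficient of the product of the amplitudes when
a superposition of exponentials is substituted for the unknowns. -/
def symb : List (Option (Fin N) × K) → DiffPoly K N →ₗ[K] K
  | [] => lcoeff K 0
  | a :: l => symb l ∘ₗ (expDeriv a).toLinearMap

theorem symb_nil (p : DiffPoly K N) : symb [] p = constantCoeff p := rfl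

theorem symb_cons (a : Option (Fin N) × K) (l : List (Option (Fin N) × K)) (p : DiffPoly K N) :
    symb (a :: l) p = symb l (expDeriv a p) := rfl

theorem constantCoeff_linFlow (n : ℕ) (α β : K) (p : DiffPoly K N) :
    constantCoeff (linFlow n α β p) = 0 := by
  induction p using MvPolynomial.induction_on with
  | C a => simp
  | add p q hp hq => rw [map_add, map_add, hp, hq, add_zero]
  | mul_X p v hp => cases v <;> simp [smul_eq_C_mul]

theorem symb_linFlow (l : List (Option (Fin N) × K)) (n : ℕ) (α β : K) (p : DiffPoly K N) :
    symb l (linFlow n α β p) = (l.map (expRate n α β)).sum * symb l p := by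
  induction l generalizing p with
  | nil => rw [symb_nil, constantCoeff_linFlow, List.map_nil, List.sum_nil, zero_mul]
  | cons a l ih =>
    rw [symb_cons, symb_cons, expDeriv_linFlow, map_add, map_smul, ih, List.map_cons,
      List.sum_cons, smul_eq_mul]
    ring

theorem symb_iterate_totalDeriv (l : List (Option (Fin N) × K)) (n : ℕ) (p : DiffPoly K N) :
    symb l ((totalDeriv K N)^[n] p) = (l.map (expRate 1 1 1)).sum ^ n * symb l p := by
  induction n generalizing p with
  | zero => simp
  | succ n ih => rw [Function.iterate_succ_apply, ih, totalDeriv_eq_linFlow, symb_linFlow]; ring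

variable {k : Type*} [Field k] [Algebra K k]

theorem map_sca (m n : ℕ) : map (algebraMap K k) (sca K N m n) = sca k N m n := by
  simp [sca, dU]

theorem map_linFlow (n : ℕ) (α β : K) (p : DiffPoly K N) :
    map (algebraMap K k) (linFlow n α β p) =
      linFlow n (algebraMap K k α) (algebraMap K k β) (map (algebraMap K k) p) := by
  induction p using MvPolynomial.induction_on with
  | C a => simp
  | add p q hp hq => simp only [map_add, hp, hq]
  | mul_X p v hp => cases v <;> simp [hp, smul_eq_C_mul, -Algebra.mul_smul_comm, -algebraMap_smul]

theorem map_iterate_totalDeriv (n : ℕ) (p : DiffPoly K N) :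
    map (algebraMap K k) ((totalDeriv K N)^[n] p) =
      (totalDeriv k N)^[n] (map (algebraMap K k) p) := by
  induction n generalizing p with
  | zero => rfl
  | succ n ih =>
    rw [Function.iterate_succ_apply, Function.iterate_succ_apply, ih, totalDeriv_eq_linFlow,
      totalDeriv_eq_linFlow, map_linFlow, map_one]

/-- If the linearised equation for `g` with source `f` is solvable, then the symbol of the source
operator times the symbol of `f` vanishes on the zero set of the symbol of the equation. -/
theorem symb_map_eq_zero {f g : DiffPoly K N} {n : ℕ} {α β γ α' β' γ' : K}
    (h : linFlow 2 α β g + γ' • (totalDeriv K N)^[n] f =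
      γ • (totalDeriv K N)^[2] g + linFlow n α' β' f)
    (l : List (Option (Fin N) × k))
    (hQ : (l.map (expRate 2 (algebraMap K k α) (algebraMap K k β))).sum =
      algebraMap K k γ * (l.map (expRate 1 1 1)).sum ^ 2)
    (hC : (l.map (expRate n (algebraMap K k α') (algebraMap K k β'))).sum ≠
      algebraMap K k γ' * (l.map (expRate 1 1 1)).sum ^ n) :
    symb l (map (algebraMap K k) f) = 0 := by
  have h' := congrArg (fun q => symb l (map (algebraMap K k) q)) h
  simp only [map_add, smul_eq_C_mul, map_mul, map_C, map_linFlow, map_iterate_totalDeriv] at h'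
  simp only [← smul_eq_C_mul, map_smul, symb_linFlow, symb_iterate_totalDeriv, smul_eq_mul] at h'
  rw [hQ] at h'
  refine (mul_eq_zero.1 ?_).resolve_left (sub_ne_zero.2 hC)
  linear_combination -h'

theorem constantCoeff_sca (m n : ℕ) : constantCoeff (sca K N m n) = 0 := by
  simp [sca, dU]

theorem expDeriv_none_sca (x : K) (m n : ℕ) : expDeriv (none, x) (sca K N m n) = 0 := by
  simp [sca, dU, expDeriv_U]

theorem expDeriv_some_sca (j : Fin N) (x : K) (m n : ℕ) :
    expDeriv (some j, x) (sca K N m n) = C (x ^ n) * X (.U j m) + C (x ^ m) * X (.U j n) := by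
  simp [sca, dU, expDeriv_U, Finset.sum_add_distrib, mul_comm]

/-- This and the next four lemmas give the symbols of the nonlinear terms of the system. The
numerical factors count the ways of distributing the exponentials over equal unknowns. -/
theorem symb_cubic (a b x y z w : k) (j : Fin N) :
    symb [(none, x), (none, y), (none, z), (some j, w)]
      (C a * (X (.u 0) ^ 2 * X (.u 1) * X (.U j 0)) + C b * (X (.u 0) ^ 3 * X (.U j 1))) =
      2 * a * (x + y + z) + 6 * b * w := by
  simp [symb_cons, symb_nil, expDeriv_u, expDeriv_U, Derivation.leibniz_pow, map_ofNat constantCoeff]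
  ring

theorem symb_sextic (a x y z w : k) (j : Fin N) :
    symb [(none, x), (none, y), (none, z), (none, 0), (none, 0), (none, 0), (some j, w)]
      (C a * (X (.u 0) ^ 6 * X (.U j 0))) = 720 * a := by
  simp [symb_cons, symb_nil, expDeriv_u, expDeriv_U, Derivation.leibniz_pow, map_ofNat constantCoeff]
  ring

theorem symb_vector_quintic (a x y z w v : k) (j : Fin N) :
    symb [(none, x), (none, y), (some j, z), (some j, w), (some j, v)]
      (C a * (X (.u 0) ^ 2 * sca k N 0 0 * X (.U j 0))) = 12 * a := by
  simp [symb_cons, symb_nil, expDeriv_u, expDeriv_U, constantCoeff_sca, expDeriv_none_sca, expDeriv_some_sca,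
    Derivation.leibniz_pow, map_ofNat constantCoeff]
  ring

theorem symb_quadratic (a z w : k) (j : Fin N) :
    symb [(some j, z), (some j, w)] (C a * sca k N 0 1) = a * (z + w) := by
  simp [symb_cons, symb_nil, expDeriv_U, expDeriv_some_sca]

theorem symb_scalar_quintic (a x y t z w : k) (j : Fin N) :
    symb [(none, x), (none, y), (none, t), (some j, z), (some j, w)]
      (C a * (X (.u 0) ^ 3 * sca k N 0 0)) = 12 * a := by
  simp [symb_cons, symb_nil, expDeriv_u, expDeriv_U, constantCoeff_sca, expDeriv_none_sca, expDeriv_some_sca,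
    Derivation.leibniz_pow, map_ofNat constantCoeff]
  ring

end

/-! ### Choosing exponents that kill the coefficients -/

section

theorem exists_quadratic_root {k : Type*} [Field k] [IsAlgClosed k] (b c : k) :
    ∃ x : k, x ^ 2 + b * x + c = 0 := by
  have hdeg : (.X ^ 2 + .C b * .X + .C c : Polynomial k).degree = 2 := by compute_degree!
  obtain ⟨x, hx⟩ := IsAlgClosed.exists_root _ (by rw [hdeg]; decide)
  exact ⟨x, by simpa using hx⟩

theorem exists_cubic_root {k : Type*} [Field k] [IsAlgClosed k] (b c d : k) :
    ∃ x : k, x ^ 3 + b * x ^ 2 + c * x + d = 0 := by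
  have hdeg : (.X ^ 3 + .C b * .X ^ 2 + .C c * .X + .C d : Polynomial k).degree = 3 := by compute_degree!
  obtain ⟨x, hx⟩ := IsAlgClosed.exists_root _ (by rw [hdeg]; decide)
  exact ⟨x, by simpa using hx⟩

theorem exists_esymm_eq {k : Type*} [Field k] [IsAlgClosed k] (p q : k) :
    ∃ x y z : k, x + y + z = 1 ∧ x * y + y * z + z * x = p ∧ x * y * z = q := by
  obtain ⟨x, hx⟩ := exists_cubic_root (-1) p (-q)
  obtain ⟨y, hy⟩ := exists_quadratic_root (-(1 - x)) (p - x * (1 - x))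
  refine ⟨x, y, 1 - x - y, by ring, ?_, ?_⟩
  · linear_combination -hy
  · linear_combination hx - x * hy

/-- The first two power sums fix the elementary symmetric functions `e₁ = 1` and `e₂ = (1 - s)/2`,
while `e₃` stays free. For `n = 3, 4` the `n`-th power sum is affine in `e₃` with slope 3 or 4, so
one of `e₃ = 0, 1` avoids the forbidden value. -/
theorem exists_power_sums {k : Type*} [Field k] [IsAlgClosed k] [CharZero k] {n : ℕ}
    (hn : n = 3 ∨ n = 4) (s b δ : k) (h : b ≠ 0 ∨ δ ≠ 0) :
    ∃ x y z : k, x + y + z = 1 ∧ x ^ 2 + y ^ 2 + z ^ 2 = s ∧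
      b * (x ^ n + y ^ n + z ^ n) + δ ≠ 0 := by
  have hs : ∀ x y z p q : k, x + y + z = 1 → x * y + y * z + z * x = p → x * y * z = q →
      x ^ 2 + y ^ 2 + z ^ 2 = 1 - 2 * p ∧ x ^ 3 + y ^ 3 + z ^ 3 = 1 - 3 * p + 3 * q ∧
        x ^ 4 + y ^ 4 + z ^ 4 = 1 - 4 * p + 2 * p ^ 2 + 4 * q := by
    rintro x y z p q h1 rfl rfl
    obtain rfl : z = 1 - x - y := by linear_combination h1
    refine ⟨?_, ?_, ?_⟩ <;> ring
  obtain ⟨x, y, z, h1, h2, h3⟩ := exists_esymm_eq ((1 - s) / 2) 0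
  obtain ⟨x', y', z', h1', h2', h3'⟩ := exists_esymm_eq ((1 - s) / 2) 1
  obtain ⟨e2, e3, e4⟩ := hs _ _ _ _ _ h1 h2 h3
  obtain ⟨e2', e3', e4'⟩ := hs _ _ _ _ _ h1' h2' h3'
  have hb : b * (x ^ n + y ^ n + z ^ n) + δ ≠ 0 ∨ b * (x' ^ n + y' ^ n + z' ^ n) + δ ≠ 0 := by
    by_contra! hc
    have hb : b = 0 := by
      rcases hn with rfl | rfl
      · rw [e3, e3'] at hc
        linear_combination (hc.2 - hc.1) / 3
      · rw [e4, e4'] at hc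
        linear_combination (hc.2 - hc.1) / 4
    rw [hb, zero_mul, zero_add] at hc
    exact h.elim (absurd hb) (absurd hc.1)
  rcases hb with hb | hb
  · exact ⟨x, y, z, h1, by rw [e2]; ring, hb⟩
  · exact ⟨x', y', z', h1', by rw [e2']; ring, hb⟩

variable {K : Type*} [Field K] [CharZero K] {N : ℕ}

section Linearised

variable {n : ℕ} {α β α' β' : K} {g : DiffPoly K N}

theorem cubic_coeff_eq_zero (hn : n = 3 ∨ n = 4) (h2 : α' ≠ 0 ∨ β' ≠ 0)
    (h3 : α ≠ 0 ∨ α' ≠ 0) {a b : K} {j : Fin N}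
    (h : linFlow 2 α β g + β' • (totalDeriv K N)^[n]
        (a • (du K N 0 ^ 2 * du K N 1 * dU K N 0 j) + b • (du K N 0 ^ 3 * dU K N 1 j)) =
      β • (totalDeriv K N)^[2] g + linFlow n α' β'
        (a • (du K N 0 ^ 2 * du K N 1 * dU K N 0 j) + b • (du K N 0 ^ 3 * dU K N 1 j))) :
    a = 0 ∧ b = 0 := by
  let k := AlgebraicClosure K
  let ι := algebraMap K k
  have hι : ∀ c, ι c = 0 ↔ c = 0 := fun c => map_eq_zero ι
  have : CharZero k := charZero_of_injective_algebraMap ι.injective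
  have key : ∀ x y z w : k, ι α * (x ^ 2 + y ^ 2 + z ^ 2) + ι β * w ^ 2 =
        ι β * (x + y + z + w) ^ 2 →
      ι α' * (x ^ n + y ^ n + z ^ n) + ι β' * (w ^ n - (x + y + z + w) ^ n) ≠ 0 →
      ι a * (x + y + z) + 3 * ι b * w = 0 := fun x y z w hQ hC => by
    have := symb_map_eq_zero h [(none, x), (none, y), (none, z), (some j, w)]
      (by simp [expRate]; linear_combination hQ)
      (by simp [expRate]; refine fun hc => hC ?_; linear_combination hc)
    simp only [map_add, map_mul, map_pow, smul_eq_C_mul, map_C, du, dU, map_X] at this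
    rw [← map_add, symb_cubic] at this
    linear_combination this / 2
  by_cases hα : α = 0
  · have hα' := h3.resolve_left (not_not.2 hα)
    have hb : b = 0 := by
      -- The `u`-exponents sum to 0, so Q = 0 and the coefficient `a` drops out of the symbol.
      have := key 1 1 (-2) 1 (by rw [hα]; simp; norm_num) (by
        have : ι α' ≠ 0 := by simpa [hι] using hα'
        rcases hn with rfl | rfl <;> norm_num [this])
      rw [← hι]
      linear_combination this / 3
    -- With `w = -1/2` and `x + y + z = 1` the total is `-w`, so Q = 0 whatever the sum of squares;
    -- the value 0 is arbitrary.
    obtain ⟨x, y, z, e1, e2, e3⟩ := exists_power_sums hn 0 (ι α')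
      (ι β' * ((-1 / 2) ^ n - (1 + -1 / 2) ^ n)) (Or.inl (by simpa [hι] using hα'))
    have := key x y z (-1 / 2) (by rw [hα, map_zero, e1]; ring) (by rwa [e1])
    rw [hb, e1, map_zero] at this
    refine ⟨?_, hb⟩
    rw [← hι]
    linear_combination this
  · have hα0 : ι α ≠ 0 := by simpa [hι] using hα
    have key' : ∀ w : k, w ^ n - (1 + w) ^ n ≠ 0 → ι a + 3 * ι b * w = 0 := fun w hw => by
      -- For `x + y + z = 1`, the equation Q = 0 prescribes the sum of squares `s`, since `(1 + w)²
      -- - w² = 1 + 2w`.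
      obtain ⟨s, hs⟩ : ∃ s, ι α * s = ι β * (1 + 2 * w) := ⟨_, mul_div_cancel₀ _ hα0⟩
      obtain ⟨x, y, z, e1, e2, e3⟩ := exists_power_sums hn s (ι α')
        (ι β' * (w ^ n - (1 + w) ^ n)) (by simpa [hι, hw] using h2)
      have := key x y z w (by rw [e1, e2, hs]; ring) (by rwa [e1])
      rw [e1] at this
      linear_combination this
    have k0 := key' 0 (by rcases hn with rfl | rfl <;> norm_num)
    have k1 := key' 1 (by rcases hn with rfl | rfl <;> norm_num)
    rw [← hι, ← hι]
    exact ⟨by linear_combination k0, by linear_combination (k1 - k0) / 3⟩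

theorem sextic_coeff_eq_zero (hn : n = 3 ∨ n = 4) (h2 : α' ≠ 0 ∨ β' ≠ 0)
    (h3 : α ≠ 0 ∨ α' ≠ 0) {a : K} {j : Fin N}
    (h : linFlow 2 α β g + β' • (totalDeriv K N)^[n] (a • (du K N 0 ^ 6 * dU K N 0 j)) =
      β • (totalDeriv K N)^[2] g + linFlow n α' β' (a • (du K N 0 ^ 6 * dU K N 0 j))) :
    a = 0 := by
  let k := AlgebraicClosure K
  let ι := algebraMap K k
  have hι : ∀ c, ι c = 0 ↔ c = 0 := fun c => map_eq_zero ι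
  have : CharZero k := charZero_of_injective_algebraMap ι.injective
  have hn0 : n ≠ 0 := by omega
  have key : ∀ x y z : k, ι α * (x ^ 2 + y ^ 2 + z ^ 2) = ι β * (x + y + z) ^ 2 →
      ι α' * (x ^ n + y ^ n + z ^ n) - ι β' * (x + y + z) ^ n ≠ 0 → a = 0 := fun x y z hQ hC => by
    -- The symbol is constant, so four exponents may be set to 0, leaving three to choose.
    have := symb_map_eq_zero h [(none, x), (none, y), (none, z), (none, 0), (none, 0), (none, 0),
        (some j, 0)]
      (by simp [expRate, -mul_eq_mul_left_iff]; linear_combination hQ)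
      (by simp [expRate, hn0]; refine fun hc => hC ?_; linear_combination hc)
    simp only [map_mul, map_pow, smul_eq_C_mul, map_C, du, dU, map_X] at this
    rw [symb_sextic] at this
    rw [← hι]
    linear_combination this / 720
  by_cases hα : α = 0
  · have hα' := h3.resolve_left (not_not.2 hα)
    refine key 1 1 (-2) (by rw [hα]; simp; norm_num) ?_
    have : ι α' ≠ 0 := by simpa [hι] using hα'
    rcases hn with rfl | rfl <;> norm_num [this]
  · have hα0 : ι α ≠ 0 := by simpa [hι] using hα
    obtain ⟨s, hs⟩ : ∃ s, ι α * s = ι β := ⟨_, mul_div_cancel₀ _ hα0⟩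
    obtain ⟨x, y, z, e1, e2, e3⟩ := exists_power_sums hn s (ι α') (-ι β')
      (by simpa [hι] using h2)
    refine key x y z (by rw [e1, e2, hs]; ring) ?_
    rw [e1]
    exact fun hc => e3 (by linear_combination hc)

theorem vector_quintic_coeff_eq_zero (hn : n = 3 ∨ n = 4) (h2 : α' ≠ 0 ∨ β' ≠ 0)
    {a : K} {j : Fin N}
    (h : linFlow 2 α β g + β' • (totalDeriv K N)^[n]
        (a • (du K N 0 ^ 2 * sca K N 0 0 * dU K N 0 j)) =
      β • (totalDeriv K N)^[2] g +
        linFlow n α' β' (a • (du K N 0 ^ 2 * sca K N 0 0 * dU K N 0 j))) :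
    a = 0 := by
  let k := AlgebraicClosure K
  let ι := algebraMap K k
  have hι : ∀ c, ι c = 0 ↔ c = 0 := fun c => map_eq_zero ι
  have : CharZero k := charZero_of_injective_algebraMap ι.injective
  have key : ∀ x y z w v : k, ι α * (x ^ 2 + y ^ 2) + ι β * (z ^ 2 + w ^ 2 + v ^ 2) =
        ι β * (x + y + z + w + v) ^ 2 →
      ι α' * (x ^ n + y ^ n) + ι β' * (z ^ n + w ^ n + v ^ n - (x + y + z + w + v) ^ n) ≠ 0 →
      a = 0 := fun x y z w v hQ hC => by
    have := symb_map_eq_zero h [(none, x), (none, y), (some j, z), (some j, w), (some j, v)]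
      (by simp [expRate]; linear_combination hQ)
      (by simp [expRate]; refine fun hc => hC ?_; linear_combination hc)
    simp only [map_mul, map_pow, smul_eq_C_mul, map_C, du, dU, map_X, map_sca] at this
    rw [symb_vector_quintic] at this
    rw [← hι]
    linear_combination this / 12
  by_cases hβ' : β' = 0
  · have hα' : ι α' ≠ 0 := by simpa [hι] using h2.resolve_right (not_not.2 hβ')
    obtain ⟨i, hi⟩ := exists_quadratic_root (0 : k) 1
    have hi2 : i ^ 2 = -1 := by linear_combination hi
    -- Here `x² + y² = 0` and `z` is minus the total of all five exponents, so Q = 0; C reduces to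
    -- `α' (1 + iⁿ)`.
    refine key 1 i (-(1 + i) / 2) 0 0 (by linear_combination ι α * hi) ?_
    rw [hβ', map_zero, zero_mul, add_zero]
    refine mul_ne_zero hα' fun hc => ?_
    rcases hn with rfl | rfl
    · exact two_ne_zero (α := k) (by linear_combination (1 + i) * hc - (i ^ 2 + i - 1) * hi)
    · exact two_ne_zero (α := k) (by linear_combination hc - (i ^ 2 - 1) * hi)
  · have hβ0 : ι β' ≠ 0 := by simpa [hι] using hβ'
    -- `2² + 2² + (-1)² = (2 + 2 - 1)²`, while the analogous equality fails for third and fourth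
    -- powers.
    refine key 0 0 2 2 (-1) (by ring) ?_
    rcases hn with rfl | rfl <;> norm_num [hβ0]

/-- When `u` has no linear part in either system, Q and C are `β` and `β'` times power sums of the
`U`-exponents. At the exponents 1 and `i` with `i² = -1` the sum of squares vanishes, but `1 + iⁿ`
does not. -/
theorem scalar_coeff_eq_zero (hn : n = 3 ∨ n = 4) (h2 : β' ≠ 0) {f : DiffPoly K N} {l : ℕ}
    (j : Fin N) (h : linFlow 2 0 β g = linFlow n 0 β' f) {i : AlgebraicClosure K}
    (hi : i ^ 2 = -1) :
    symb (List.replicate l (none, 0) ++ [(some j, 1), (some j, i)])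
      (map (algebraMap K (AlgebraicClosure K)) f) = 0 := by
  have : CharZero (AlgebraicClosure K) :=
    charZero_of_injective_algebraMap (algebraMap K _).injective
  have hβ' : algebraMap K (AlgebraicClosure K) β' ≠ 0 := by simpa using h2
  refine symb_map_eq_zero (g := g) (n := n) (α := 0) (β := β) (γ := 0) (α' := 0) (β' := β') (γ' := 0)
    (by rw [zero_smul, zero_smul, add_zero, zero_add, h])
    _ ?_ ?_
  · simp [expRate, hi]
  · rw [map_zero, zero_mul]
    simp only [expRate, List.map_append, List.map_replicate, List.sum_append, List.sum_replicate,
      if_true, List.map_cons, List.map_nil, List.sum_cons,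
      List.sum_nil, reduceCtorEq, if_false, one_pow, add_zero, ← mul_add]
    rw [zero_mul, smul_zero, zero_add]
    refine mul_ne_zero hβ' fun hc => two_ne_zero (α := AlgebraicClosure K) ?_
    rcases hn with rfl | rfl
    · linear_combination (1 + i) * hc - (i ^ 2 + i - 1) * hi
    · linear_combination hc - (i ^ 2 - 1) * hi

theorem quadratic_coeff_eq_zero (hn : n = 3 ∨ n = 4) (h2 : β' ≠ 0) {a : K} (j : Fin N)
    (h : linFlow 2 0 β g = linFlow n 0 β' (a • sca K N 0 1)) : a = 0 := by
  obtain ⟨i, hi⟩ := exists_quadratic_root (0 : AlgebraicClosure K) 1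
  have hi2 : i ^ 2 = -1 := by linear_combination hi
  have : CharZero (AlgebraicClosure K) :=
    charZero_of_injective_algebraMap (algebraMap K _).injective
  have h0 := scalar_coeff_eq_zero (l := 0) hn h2 j h hi2
  simp only [map_mul, smul_eq_C_mul, map_C, map_sca, List.replicate_zero, List.nil_append] at h0
  rw [symb_quadratic] at h0
  refine (map_eq_zero (algebraMap K (AlgebraicClosure K))).1 ((mul_eq_zero.1 h0).resolve_right ?_)
  exact fun hc => two_ne_zero (α := AlgebraicClosure K) (by
    linear_combination hi2 + (1 - i) * hc)

theorem scalar_quintic_coeff_eq_zero (hn : n = 3 ∨ n = 4) (h2 : β' ≠ 0) {a : K} (j : Fin N)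
    (h : linFlow 2 0 β g = linFlow n 0 β' (a • (du K N 0 ^ 3 * sca K N 0 0))) : a = 0 := by
  obtain ⟨i, hi⟩ := exists_quadratic_root (0 : AlgebraicClosure K) 1
  have hi2 : i ^ 2 = -1 := by linear_combination hi
  have : CharZero (AlgebraicClosure K) :=
    charZero_of_injective_algebraMap (algebraMap K _).injective
  have h0 := scalar_coeff_eq_zero (l := 3) hn h2 j h hi2
  simp only [map_mul, map_pow, smul_eq_C_mul, map_C, map_sca, du, map_X] at h0
  -- The list built with `List.replicate` matches the literal list only after unfolding.
  erw [symb_scalar_quintic] at h0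
  rw [← map_eq_zero (algebraMap K (AlgebraicClosure K))]
  linear_combination h0 / 12

end Linearised

end

/-! ### The component equations and the exclusion of symmetries -/

section

variable {K : Type*} [Field K] {N : ℕ}

namespace EvolSystem

theorem flow_smul_du (S : EvolSystem K N) (c : K) (n : ℕ) :
    S.flow (c • du K N n) = c • (totalDeriv K N)^[n] S.scalar := by
  rw [Derivation.map_smul, du, flow_u]

theorem flow_smul_dU (S : EvolSystem K N) (c : K) (n : ℕ) (j : Fin N) :
    S.flow (c • dU K N n j) = c • (totalDeriv K N)^[n] (S.vector j) := by
  rw [Derivation.map_smul, dU, flow_U]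

theorem part_scalar_eq_zero (T : EvolSystem K N) {e : ℤ × ℤ} (he : e.1 < -1 ∨ e.2 < 0) :
    (T.part e).scalar = 0 :=
  bicomp_eq_zero_of_neg (by simp only [Prod.fst_add, Prod.snd_add]; omega) _

theorem part_vector_eq_zero (T : EvolSystem K N) {e : ℤ × ℤ} (he : e.1 < 0 ∨ e.2 < -1)
    (j : Fin N) : (T.part e).vector j = 0 :=
  bicomp_eq_zero_of_neg (by simp only [Prod.fst_add, Prod.snd_add]; omega) _

end EvolSystem

theorem secondOrderPart_zero_flow (a : Fin 10 → K) :
    (secondOrderPart N a 0).flow = linFlow 2 (a 0) (a 5) :=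
  EvolSystem.flow_eq_linFlow rfl fun _ => rfl

section Commutator

variable {a : Fin 10 → K} {T : EvolSystem K N}

theorem EvolSystem.IsSymmetry.scalar_eq (h : T.IsSymmetry (secondOrder N a)) (e : ℤ × ℤ) :
    linFlow 2 (a 0) (a 5) (T.part e).scalar +
        (secondOrderPart N a 1).flow (T.part (e - (3, 0))).scalar +
        (secondOrderPart N a 2).flow (T.part (e - (6, 0))).scalar +
        (secondOrderPart N a 3).flow (T.part (e - (-1, 2))).scalar +
        (secondOrderPart N a 4).flow (T.part (e - (2, 2))).scalar =
      a 0 • (totalDeriv K N)^[2] (T.part e).scalar +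
        (T.part (e - (3, 0))).flow (secondOrderPart N a 1).scalar +
        (T.part (e - (6, 0))).flow (secondOrderPart N a 2).scalar +
        (T.part (e - (-1, 2))).flow (secondOrderPart N a 3).scalar +
        (T.part (e - (2, 2))).flow (secondOrderPart N a 4).scalar := by
  have h1 := (h.part_commute (secondOrderPart_isShift a) (secondOrder_scalar a)
    (secondOrder_vector a) e).1
  rw [Fin.sum_univ_five, Fin.sum_univ_five, secondOrderPart_zero_flow,
    show secondOrderShift 0 = 0 from rfl, sub_zero,
    show (secondOrderPart N a 0).scalar = a 0 • du K N 2 from rfl, flow_smul_du] at h1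
  exact h1

theorem EvolSystem.IsSymmetry.vector_eq (h : T.IsSymmetry (secondOrder N a)) (e : ℤ × ℤ)
    (j : Fin N) :
    linFlow 2 (a 0) (a 5) ((T.part e).vector j) +
        (secondOrderPart N a 1).flow ((T.part (e - (3, 0))).vector j) +
        (secondOrderPart N a 2).flow ((T.part (e - (6, 0))).vector j) +
        (secondOrderPart N a 3).flow ((T.part (e - (-1, 2))).vector j) +
        (secondOrderPart N a 4).flow ((T.part (e - (2, 2))).vector j) =
      a 5 • (totalDeriv K N)^[2] ((T.part e).vector j) +
        (T.part (e - (3, 0))).flow ((secondOrderPart N a 1).vector j) +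
        (T.part (e - (6, 0))).flow ((secondOrderPart N a 2).vector j) +
        (T.part (e - (-1, 2))).flow ((secondOrderPart N a 3).vector j) +
        (T.part (e - (2, 2))).flow ((secondOrderPart N a 4).vector j) := by
  have h1 := (h.part_commute (secondOrderPart_isShift a) (secondOrder_scalar a)
    (secondOrder_vector a) e).2 j
  rw [Fin.sum_univ_five, Fin.sum_univ_five, secondOrderPart_zero_flow,
    show secondOrderShift 0 = 0 from rfl, sub_zero,
    show (secondOrderPart N a 0).vector j = a 5 • dU K N 2 j from rfl, flow_smul_dU] at h1
  exact h1

variable [CharZero K] {n : ℕ} {α β : K}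

/-- A symmetry whose linear part involves `u`, or of a system whose linear part involves `u`,
forces the vector equation to be linear and uncoupled. -/
theorem vector_coeffs_eq_zero (hn : n = 3 ∨ n = 4) (j : Fin N)
    (hT : (T.part 0).flow = linFlow n α β) (hv : (T.part 0).vector j = β • dU K N n j)
    (h : T.IsSymmetry (secondOrder N a)) (h1 : a 0 ≠ 0 ∨ a 5 ≠ 0) (h2 : α ≠ 0 ∨ β ≠ 0)
    (h3 : a 0 ≠ 0 ∨ α ≠ 0) : a 6 = 0 ∧ a 7 = 0 ∧ a 8 = 0 ∧ a 9 = 0 := by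
  have e30 := h.vector_eq (3, 0) j
  rw [show ((3, 0) - (3, 0) : ℤ × ℤ) = 0 from rfl, hT, hv, EvolSystem.flow_smul_dU,
    T.part_vector_eq_zero (e := (3, 0) - (6, 0)) (by decide),
    T.part_vector_eq_zero (e := (3, 0) - (-1, 2)) (by decide),
    T.part_vector_eq_zero (e := (3, 0) - (2, 2)) (by decide),
    T.part_flow_eq_zero (e := (3, 0) - (6, 0)) (by decide),
    T.part_flow_eq_zero (e := (3, 0) - (-1, 2)) (by decide),
    T.part_flow_eq_zero (e := (3, 0) - (2, 2)) (by decide)] at e30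
  simp only [map_zero, add_zero, Derivation.zero_apply] at e30
  obtain ⟨h6, h7⟩ := cubic_coeff_eq_zero hn h2 h3 e30
  have hP1 : ∀ j, (secondOrderPart N a 1).vector j = 0 := fun j => by
    simp [secondOrderPart, cubicPart, h6, h7]
  -- With the source gone, the (3,0) equation is homogeneous, so `T` has no vector part of this
  -- shift and cannot disturb the shifts (6,0) and (2,2).
  rw [hP1, map_zero, iterate_totalDeriv_eq_pow, map_zero, smul_zero, add_zero, add_zero] at e30
  have hQ : (T.part (3, 0)).vector j = 0 :=
    eq_zero_of_linFlow_eq (isBihom_bicomp _ _) h1 e30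
  have e60 := h.vector_eq (6, 0) j
  rw [hP1, show ((6, 0) - (6, 0) : ℤ × ℤ) = 0 from rfl,
    show ((6, 0) - (3, 0) : ℤ × ℤ) = (3, 0) from rfl, hT, hv, hQ, EvolSystem.flow_smul_dU,
    T.part_vector_eq_zero (e := (6, 0) - (-1, 2)) (by decide),
    T.part_vector_eq_zero (e := (6, 0) - (2, 2)) (by decide),
    T.part_flow_eq_zero (e := (6, 0) - (-1, 2)) (by decide),
    T.part_flow_eq_zero (e := (6, 0) - (2, 2)) (by decide)] at e60
  simp only [map_zero, add_zero, Derivation.zero_apply] at e60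
  have h8 := sextic_coeff_eq_zero hn h2 h3 e60
  have e22 := h.vector_eq (2, 2) j
  rw [hP1, show ((2, 2) - (2, 2) : ℤ × ℤ) = 0 from rfl,
    show ((2, 2) - (-1, 2) : ℤ × ℤ) = (3, 0) from rfl, hT, hv, hQ, EvolSystem.flow_smul_dU,
    T.part_vector_eq_zero (e := (2, 2) - (3, 0)) (by decide),
    T.part_vector_eq_zero (e := (2, 2) - (6, 0)) (by decide),
    T.part_flow_eq_zero (e := (2, 2) - (6, 0)) (by decide),
    show (secondOrderPart N a 3).vector j = 0 from rfl] at e22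
  simp only [map_zero, add_zero, Derivation.zero_apply] at e22
  exact ⟨h6, h7, h8, vector_quintic_coeff_eq_zero hn h2 e22⟩

theorem scalar_coeffs_eq_zero (hn : n = 3 ∨ n = 4) (j : Fin N)
    (hT : (T.part 0).flow = linFlow n 0 β) (hs : (T.part 0).scalar = 0)
    (h : T.IsSymmetry (secondOrder N a)) (h0 : a 0 = 0) (h5 : a 5 ≠ 0) (hβ : β ≠ 0) :
    a 3 = 0 ∧ a 4 = 0 := by
  have e02 := h.scalar_eq (-1, 2)
  rw [show ((-1, 2) - (-1, 2) : ℤ × ℤ) = 0 from rfl, hT, hs, h0,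
    T.part_scalar_eq_zero (e := (-1, 2) - (3, 0)) (by decide),
    T.part_scalar_eq_zero (e := (-1, 2) - (6, 0)) (by decide),
    T.part_scalar_eq_zero (e := (-1, 2) - (2, 2)) (by decide),
    T.part_flow_eq_zero (e := (-1, 2) - (3, 0)) (by decide),
    T.part_flow_eq_zero (e := (-1, 2) - (6, 0)) (by decide),
    T.part_flow_eq_zero (e := (-1, 2) - (2, 2)) (by decide)] at e02
  simp only [map_zero, add_zero, zero_add, zero_smul, Derivation.zero_apply] at e02
  have h3 := quadratic_coeff_eq_zero hn hβ j e02
  have hP3s : (secondOrderPart N a 3).scalar = 0 := by simp [secondOrderPart, h3]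
  have hP3 : (secondOrderPart N a 3).flow = 0 :=
    EvolSystem.flow_eq_zero hP3s fun _ => rfl
  rw [hP3s, map_zero] at e02
  -- The homogeneous equation with `a 5 ≠ 0` has no nonzero solution involving `U`. The vector part
  -- of this shift vanishes too, as its degree in `u` would be -1.
  have hQ : (T.part (-1, 2)).scalar = 0 := by
    by_contra hne
    exact linFlow_ne_zero_of_U two_ne_zero h5
      (exists_U_mem_vars (isBihom_bicomp _ _) hne (by decide)) e02
  have hQf : (T.part (-1, 2)).flow = 0 :=
    EvolSystem.flow_eq_zero hQ fun j => T.part_vector_eq_zero (by decide) j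
  have e22 := h.scalar_eq (2, 2)
  rw [show ((2, 2) - (2, 2) : ℤ × ℤ) = 0 from rfl,
    show ((2, 2) - (3, 0) : ℤ × ℤ) = (-1, 2) from rfl, hT, hs, h0, hQ, hP3, hP3s, hQf,
    T.part_scalar_eq_zero (e := (2, 2) - (6, 0)) (by decide),
    T.part_flow_eq_zero (e := (2, 2) - (6, 0)) (by decide)] at e22
  simp only [map_zero, add_zero, zero_add, zero_smul, Derivation.zero_apply] at e22
  exact ⟨h3, scalar_quintic_coeff_eq_zero hn hβ j e22⟩

/-- A coupled second-order system has no symmetry with a nonzero linear part of order `3` or `4`. -/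
theorem not_isSymmetry_of_linear_part (hn : n = 3 ∨ n = 4) (hN : 1 ≤ N)
    (ha : IsCoupledSecondOrder a) (h2 : α ≠ 0 ∨ β ≠ 0)
    (hs : bicomp (1, 0) T.scalar = α • du K N n)
    (hv : ∀ j, bicomp (0, 1) (T.vector j) = β • dU K N n j) :
    ¬ T.IsSymmetry (secondOrder N a) := by
  intro h
  have hs' : (T.part 0).scalar = α • du K N n := by rw [← hs, EvolSystem.part, zero_add]
  have hv' : ∀ j, (T.part 0).vector j = β • dU K N n j := fun j => by
    rw [← hv]
    simp only [EvolSystem.part, zero_add]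
  have hT := EvolSystem.flow_eq_linFlow hs' hv'
  obtain ⟨ha1, ha2, ha3⟩ := ha
  by_cases h3 : a 0 ≠ 0 ∨ α ≠ 0
  · obtain ⟨h6, h7, h8, h9⟩ := vector_coeffs_eq_zero hn ⟨0, hN⟩ hT (hv' _) h ha1 h2 h3
    simp [h6, h7, h8, h9] at ha3
  · obtain ⟨h0, rfl⟩ : a 0 = 0 ∧ α = 0 := by simpa only [not_or, not_not] using h3
    rw [zero_smul] at hs'
    obtain ⟨h3, h4⟩ := scalar_coeffs_eq_zero hn ⟨0, hN⟩ hT hs' h h0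
      (ha1.resolve_left (not_not.2 h0)) (h2.resolve_left (not_not.2 rfl))
    simp [h3, h4] at ha2

end Commutator

end

/-! ### Linear parts of third- and fourth-order symmetries -/

section

section Weights

theorem eq_zero_of_weight_eq_zero {σ M : Type*} [AddCommMonoid M] [PartialOrder M]
    [IsOrderedAddMonoid M] {w : σ → M} (hw : ∀ v, 0 < w v) {m : σ →₀ ℕ}
    (h : Finsupp.weight w m = 0) : m = 0 := by
  ext v
  by_contra hv
  exact ((hw v).trans_le (Finsupp.le_weight_of_ne_zero (fun s => (hw s).le) hv)).ne' h

theorem eq_single_of_weight_eq {σ M : Type*} [AddCommGroup M] [PartialOrder M]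
    [IsOrderedAddMonoid M] {w : σ → M} (hw : ∀ v, 0 < w v) {m : σ →₀ ℕ} {v : σ} (hv : m v ≠ 0)
    (h : Finsupp.weight w m = w v) : m = Finsupp.single v 1 := by
  have h1 := Finsupp.weight_sub_single_add (w := w) hv
  rw [h, add_eq_right] at h1
  have h2 := eq_zero_of_weight_eq_zero hw h1
  have hle : Finsupp.single v 1 ≤ m :=
    Finsupp.single_le_iff.2 (Nat.one_le_iff_ne_zero.2 hv)
  rw [← tsub_add_cancel_of_le hle, h2, zero_add]

variable {N : ℕ}

theorem bidegree_pos (v : JetVar N) : 0 < bidegree v := by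
  cases v <;> simp [bidegree, Prod.lt_iff]

theorem weight_pos (v : JetVar N) : 0 < v.weight := by
  cases v <;> simp only [JetVar.weight] <;> positivity

theorem exists_eq_single_of_weight_bidegree {m : JetVar N →₀ ℕ} {e : ℤ × ℤ} (he : e ≠ 0)
    (h : Finsupp.weight bidegree m = e) (h1 : e = (1, 0) ∨ e = (0, 1)) :
    ∃ v, m = Finsupp.single v 1 ∧ bidegree v = e := by
  have hm : m ≠ 0 := by
    rintro rfl
    exact he (by rw [← h, map_zero])
  obtain ⟨v, hv⟩ := Finsupp.ne_iff.1 hm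
  have hle : bidegree v ≤ e := by
    rw [← h]
    exact Finsupp.le_weight_of_ne_zero (fun s => (bidegree_pos s).le) hv
  have hve : bidegree v = e := by
    rcases h1 with rfl | rfl <;> cases v <;> simp [bidegree, Prod.le_def] at hle ⊢
  exact ⟨v, eq_single_of_weight_eq bidegree_pos hv (h.trans hve.symm), hve⟩

end Weights

variable {K : Type*} [Field K] {N : ℕ}

theorem bicomp_u_eq {p : DiffPoly K N} {n : ℕ} {c : K}
    (h : ∀ i, coeff (Finsupp.single (.u i) 1) p = if i = n then c else 0) :
    bicomp (1, 0) p = c • du K N n := by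
  classical
  ext m
  rw [coeff_weightedHomogeneousComponent, coeff_smul, du, coeff_X, smul_eq_mul]
  split_ifs with h1 h2 h2
  · rw [← h2, h, if_pos rfl, mul_one]
  · obtain ⟨v, rfl, hv⟩ := exists_eq_single_of_weight_bidegree (by decide) h1 (Or.inl rfl)
    cases v with
    | u i => rw [h, if_neg (by rintro rfl; exact h2 rfl), mul_zero]
    | U j i => simp [bidegree] at hv
  · exact absurd (by rw [← h2, Finsupp.weight_single, one_smul]; rfl) h1
  · rw [mul_zero]

theorem bicomp_U_eq {p : DiffPoly K N} {j : Fin N} {n : ℕ} {c : K}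
    (h : ∀ j' i, coeff (Finsupp.single (.U j' i) 1) p = if j' = j ∧ i = n then c else 0) :
    bicomp (0, 1) p = c • dU K N n j := by
  classical
  ext m
  rw [coeff_weightedHomogeneousComponent, coeff_smul, dU, coeff_X, smul_eq_mul]
  split_ifs with h1 h2 h2
  · rw [← h2, h, if_pos ⟨rfl, rfl⟩, mul_one]
  · obtain ⟨v, rfl, hv⟩ := exists_eq_single_of_weight_bidegree (by decide) h1 (Or.inr rfl)
    cases v with
    | u i => simp [bidegree] at hv
    | U j' i => rw [h, if_neg (by rintro ⟨rfl, rfl⟩; exact h2 rfl), mul_zero]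
  · exact absurd (by rw [← h2, Finsupp.weight_single, one_smul]; rfl) h1
  · rw [mul_zero]

/-- A linear term arises only from the constant term of a scalar coefficient times `∂ₓᵏ U`. Its
coefficient is therefore the same for all components, which makes the linear part a single multiple
`β`. -/
theorem exists_linear_coeff_of_mem_vectorPolys {G : Fin N → DiffPoly K N}
    (hG : G ∈ vectorPolys K N) : ∃ c : ℕ → K, ∀ j j' i,
      coeff (Finsupp.single (.U j' i) 1) (G j) = if j' = j then c i else 0 := by
  classical
  induction hG using Submodule.span_induction with
  | mem G hG =>
    obtain ⟨p, -, k, rfl⟩ := hG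
    refine ⟨fun i => if i = k then coeff 0 p else 0, fun j j' i => ?_⟩
    rw [Pi.smul_apply, smul_eq_mul, dU, coeff_mul_X']
    by_cases h : j' = j ∧ i = k
    · obtain ⟨rfl, rfl⟩ := h
      simp
    · have h' : JetVar.U j k ∉ (Finsupp.single (JetVar.U j' i) 1).support := by
        rw [Finsupp.support_single _ one_ne_zero, Finset.mem_singleton, JetVar.U.injEq]
        exact fun hc => h ⟨hc.1.symm, hc.2.symm⟩
      rw [if_neg h']
      by_cases h1 : j' = j
      · rw [if_pos h1]
        exact (if_neg fun h2 => h ⟨h1, h2⟩).symm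
      · rw [if_neg h1]
  | zero => exact ⟨0, fun j j' i => by simp⟩
  | add G H _ _ hG hH =>
    obtain ⟨c, hc⟩ := hG
    obtain ⟨d, hd⟩ := hH
    refine ⟨c + d, fun j j' i => ?_⟩
    rw [Pi.add_apply, coeff_add, hc, hd]
    split_ifs <;> simp
  | smul a G _ hG =>
    obtain ⟨c, hc⟩ := hG
    refine ⟨a • c, fun j j' i => ?_⟩
    rw [Pi.smul_apply, coeff_smul, hc]
    split_ifs <;> simp

/-- Weight alone would allow the fourth-order term `u u_4` in the vector equation; the compulsory
factor from `U` rules it out. -/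
theorem exists_U_of_mem_vectorPolys {G : Fin N → DiffPoly K N} (hG : G ∈ vectorPolys K N)
    (j : Fin N) (m : JetVar N →₀ ℕ) (hm : coeff m (G j) ≠ 0) : ∃ k, m (.U j k) ≠ 0 := by
  classical
  induction hG using Submodule.span_induction with
  | mem G hG =>
    obtain ⟨p, -, k, rfl⟩ := hG
    rw [Pi.smul_apply, smul_eq_mul, dU, coeff_mul_X'] at hm
    exact ⟨k, Finsupp.mem_support_iff.1 (of_not_not fun h => hm (if_neg h))⟩
  | zero => simp at hm
  | add G H _ _ hG hH =>
    rw [Pi.add_apply, coeff_add] at hm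
    by_cases h : coeff m (G j) = 0
    · exact hH (by rwa [h, zero_add] at hm)
    · exact hG h
  | smul a G _ hG =>
    rw [Pi.smul_apply, coeff_smul, smul_eq_mul] at hm
    exact hG (right_ne_zero_of_mul hm)

/-- The linear part of a fourth-order symmetry. -/
theorem EvolSystem.IsFourthOrderSymmetryAnsatz.exists_linear_part {T : EvolSystem K N}
    (hT : T.IsFourthOrderSymmetryAnsatz) : ∃ α β : K, (α ≠ 0 ∨ β ≠ 0) ∧
      bicomp (1, 0) T.scalar = α • du K N 4 ∧
        ∀ j, bicomp (0, 1) (T.vector j) = β • dU K N 4 j := by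
  classical
  obtain ⟨⟨-, hG, hs, hv⟩, hord, -, -⟩ := hT
  obtain ⟨c, hc⟩ := exists_linear_coeff_of_mem_vectorPolys hG
  refine ⟨coeff (Finsupp.single (.u 4) 1) T.scalar, c 4, ?_, bicomp_u_eq fun i => ?_,
    fun j => bicomp_U_eq fun j' i => ?_⟩
  · rcases hord with ⟨v, hv4, h4⟩ | ⟨j, v, hv4, h4⟩
    · left
      obtain ⟨m, hm, hvm⟩ := (mem_vars_iff_mem_support v).1 hv4
      have hw := hs (mem_support_iff.1 hm)
      have hle := Finsupp.le_weight_of_ne_zero (fun s : JetVar N => (weight_pos s).le)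
        (Finsupp.mem_support_iff.1 hvm)
      rw [hw] at hle
      cases v with
      | u i =>
        obtain rfl : i = 4 := h4
        rw [← eq_single_of_weight_eq weight_pos (Finsupp.mem_support_iff.1 hvm)
          (hw.trans (by simp only [JetVar.weight]; norm_num))]
        exact mem_support_iff.1 hm
      | U j i =>
        obtain rfl : i = 4 := h4
        -- `∂ₓ⁴ U_j` weighs `4 + 2/3`, more than the scalar equation allows.
        norm_num [JetVar.weight] at hle
    · right
      obtain ⟨m, hm, hvm⟩ := (mem_vars_iff_mem_support v).1 hv4
      have hw := hv j (mem_support_iff.1 hm)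
      obtain ⟨k, hk⟩ := exists_U_of_mem_vectorPolys hG j m (mem_support_iff.1 hm)
      have h4w : (4 : ℚ) + 1 / 3 ≤ v.weight := by
        cases v <;> simp only [JetVar.order] at h4 <;> subst h4 <;> norm_num [JetVar.weight]
      -- Otherwise the monomial would contain a fourth-order variable and a further `U` factor, with
      -- weight at least `4 + 1/3 + 2/3`, exceeding `4 + 2/3`.
      obtain rfl : v = .U j k := by
        by_contra hne
        have hadd := Finsupp.weight_sub_single_add (w := JetVar.weight)
          (Finsupp.mem_support_iff.1 hvm)
        have hle := Finsupp.le_weight_of_ne_zero (fun s : JetVar N => (weight_pos s).le)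
          (s := .U j k) (f := m - Finsupp.single v 1) (by simpa [hne] using hk)
        have : (2 : ℚ) / 3 ≤ (JetVar.U j k).weight := by simp [JetVar.weight]
        linarith
      obtain rfl : k = 4 := h4
      have := hc j j 4
      rw [if_pos rfl, ← eq_single_of_weight_eq weight_pos hk
        (hw.trans (by simp only [JetVar.weight]; norm_num))] at this
      rw [← this]
      exact mem_support_iff.1 hm
  · split_ifs with h
    · rw [h]
    · by_contra hne
      have := hs hne
      rw [Finsupp.weight_single, one_smul] at this
      simp only [JetVar.weight] at this
      exact h (by exact_mod_cast (by push_cast at *; linarith : (i : ℚ) = 4))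
  · rw [hc]
    by_cases h : j' = j
    · subst h
      simp only [if_true, true_and]
      split_ifs with h
      · rw [h]
      · by_contra hne
        have h1 := hc j' j' i
        rw [if_pos rfl] at h1
        have := hv j' (h1.trans_ne hne)
        rw [Finsupp.weight_single, one_smul] at this
        simp only [JetVar.weight] at this
        exact h (by exact_mod_cast (by push_cast at *; linarith : (i : ℚ) = 4))
    · simp [h]

theorem bicomp_thirdOrder_scalar (b : Fin 24 → K) :
    bicomp (1, 0) (thirdOrder N b).scalar = b 0 • du K N 3 := by
  have hu := isBihom_du (K := K) (N := N)
  have hs := isBihom_sca (K := K) (N := N)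
  simp only [thirdOrder, map_add, map_smul]
  rw [bicomp_same (hu 3), bicomp_ne (((hu 0).pow 3).mul (hu 2)) (by decide),
    bicomp_ne (((hu 0).pow 2).mul ((hu 1).pow 2)) (by decide),
    bicomp_ne (((hu 0).pow 6).mul (hu 1)) (by decide), bicomp_ne ((hu 0).pow 10) (by decide),
    bicomp_ne (hs 0 2) (by decide), bicomp_ne (hs 1 1) (by decide),
    bicomp_ne ((((hu 0).pow 2).mul (hu 1)).mul (hs 0 0)) (by decide),
    bicomp_ne (((hu 0).pow 3).mul (hs 0 1)) (by decide),
    bicomp_ne (((hu 0).pow 6).mul (hs 0 0)) (by decide),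
    bicomp_ne (((hu 0).pow 2).mul ((hs 0 0).pow 2)) (by decide)]
  simp only [smul_zero, add_zero]

theorem bicomp_thirdOrder_vector (b : Fin 24 → K) (j : Fin N) :
    bicomp (0, 1) ((thirdOrder N b).vector j) = b 11 • dU K N 3 j := by
  have hu := isBihom_du (K := K) (N := N)
  have hU := fun i => isBihom_dU (K := K) (N := N) i j
  have hs := isBihom_sca (K := K) (N := N)
  simp only [thirdOrder, Pi.add_apply, Pi.smul_apply, smul_eq_mul, map_add, map_smul]
  rw [bicomp_same (hU 3), bicomp_ne ((((hu 0).pow 2).mul (hu 2)).mul (hU 0)) (by decide),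
    bicomp_ne (((hu 0).mul ((hu 1).pow 2)).mul (hU 0)) (by decide),
    bicomp_ne ((((hu 0).pow 2).mul (hu 1)).mul (hU 1)) (by decide),
    bicomp_ne (((hu 0).pow 3).mul (hU 2)) (by decide),
    bicomp_ne ((((hu 0).pow 5).mul (hu 1)).mul (hU 0)) (by decide),
    bicomp_ne (((hu 0).pow 6).mul (hU 1)) (by decide),
    bicomp_ne (((hu 0).pow 9).mul (hU 0)) (by decide),
    bicomp_ne ((((hu 0).mul (hu 1)).mul (hs 0 0)).mul (hU 0)) (by decide),
    bicomp_ne ((((hu 0).pow 2).mul (hs 0 0)).mul (hU 1)) (by decide),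
    bicomp_ne ((((hu 0).pow 2).mul (hs 0 1)).mul (hU 0)) (by decide),
    bicomp_ne ((((hu 0).pow 5).mul (hs 0 0)).mul (hU 0)) (by decide),
    bicomp_ne (((hu 0).mul ((hs 0 0).pow 2)).mul (hU 0)) (by decide)]
  simp only [smul_zero, add_zero]

end

end

end MixedEvolution

theorem mainTheorem12 {K : Type*} [Field K] [CharZero K] (N : ℕ) (hN : 1 ≤ N)
    (a : Fin 10 → K) (ha : MixedEvolution.IsCoupledSecondOrder a) :
    (¬ ∃ b : Fin 24 → K, MixedEvolution.IsThirdOrderSymmetryAnsatz b ∧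
        (MixedEvolution.thirdOrder N b).IsSymmetry (MixedEvolution.secondOrder N a)) ∧
    (¬ ∃ T : MixedEvolution.EvolSystem K N, T.IsFourthOrderSymmetryAnsatz ∧
        T.IsSymmetry (MixedEvolution.secondOrder N a)) := by
  constructor
  · rintro ⟨b, hb, h⟩
    exact MixedEvolution.not_isSymmetry_of_linear_part (Or.inl rfl) hN ha hb.1
      (MixedEvolution.bicomp_thirdOrder_scalar b) (MixedEvolution.bicomp_thirdOrder_vector b) h
  · rintro ⟨T, hT, h⟩
    obtain ⟨α, β, h2, hs, hv⟩ := hT.exists_linear_part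
    exact MixedEvolution.not_isSymmetry_of_linear_part (Or.inr rfl) hN ha h2 hs hv h
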